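/- Let $S$ be a finite set and $m$ a Coxeter matrix on $S$ whose Coxeter group $\mathcal W$ is finite. Let $\mathcal A$ be the associated Artin group, $\mathcal A^+\subset\mathcal A$ the submonoid generated by $S$, and $\pi\colon\mathcal A\to\mathcal W$ the natural homomorphism. For $x,y\in\mathcal A$ write $x<y$ if $y=xz$ for some $z\in\mathcal A^+$. An atom is an element $A\in\mathcal A^+$ whose word-length in $\mathcal A^+$ equals the word-length of $\pi(A)$ in $\mathcal W$, and $\Delta$ is the atom that corresponds to the longest element of $\mathcal W$. For $g\in\mathcal A^+$ let $\alpha(g)$ be the largest atom $A$ (with respect to $<$) such that $A<g$. A product $B_1B_2\cdots B_k$ of nontrivial atoms is a normal form if $B_i=\alpha(B_iB_{i+1}\cdots B_k)$ for all $i$. Let $V=\mathcal A/\langle\Delta\rangle$ be the set of left cosets, called vertices, with the left action of $\mathcal A$ and the basepoint $*=\langle\Delta\rangle$. Each vertex $v$ has a unique representative in $\mathcal A^+$ whose normal form $B_1\cdots B_k$ contains no $\Delta$. Put $|v|=k$, let $\|v\|$ be the word-length of $B_1\cdots B_k$, and let the geodesic from $*$ to $v$ be the sequence of vertices represented by $1,\;B_1,\;B_1B_2,\;\dots,\;B_1B_2\cdots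 B_k$. Let $d_{at},d_{wd}\colon V\times V\to\{0,1,2,\dots\}$ be the unique left-invariant functions with $d_{at}(*,v)=|v|$ and $d_{wd}(*,v)=\|v\|$ for all $v\in V$; the geodesic from $v=g(*)$ to $w$ is the left translate by $g$ of the geodesic from $*$ to $g^{-1}(w)$ (this does not depend on the choice of $g$). **Theorem.** Suppose that $p$ is a vertex on the geodesic from $v$ to $w$ with $v\neq p\neq w$, and let $u$ be any vertex. Then $$d_{at}(u,p)\leq\max\{d_{at}(u,v),d_{at}(u,w)\}$$ and $$d_{wd}(u,p)<\max\{d_{wd}(u,v),d_{wd}(u,w)\}.$$ Moreover, $$d_{wd}(u,p)\leq\max\{d_{wd}(u,v),d_{wd}(u,w)\}-\min\{d_{at}(v,p),d_{at}(w,p)\}.$$ -/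

import Mathlib

namespace CoxeterMatrix

noncomputable section

variable {B : Type*} (M : CoxeterMatrix B)

/-- The braid relators `prod(s, s', m(s, s')) * prod(s', s, m(s', s))⁻¹`. The word
`CoxeterSystem.braidWord M i j` is the alternating word in `i`, `j` of length `M i j`; the entry
`M i j = 0` encodes `m = ∞` and then the relator is trivial. -/
def artinRelations : Set (FreeGroup B) :=
  {r | ∃ i j : B, r =
    ((CoxeterSystem.braidWord M i j).map FreeGroup.of).prod *
      ((CoxeterSystem.braidWord M j i).map FreeGroup.of).prod⁻¹}

/-- The Artin group `𝒜` of the Coxeter matrix `M`. -/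
def ArtinGroup : Type _ := PresentedGroup M.artinRelations

instance instGroupArtinGroup : Group M.ArtinGroup :=
  inferInstanceAs (Group (PresentedGroup M.artinRelations))

/-- The standard generator of the Artin group. -/
def artinGen (i : B) : M.ArtinGroup := PresentedGroup.of i

/-- The element of the Artin group represented by a positive word. -/
def positiveWord (ω : List B) : M.ArtinGroup := (ω.map M.artinGen).prod

/-- The monoid `𝒜⁺` of positive words, the submonoid of `𝒜` generated by `S`. -/
def artinMonoid : Submonoid M.ArtinGroup := Submonoid.closure (Set.range M.artinGen)

/-- The word-length in `𝒜⁺` (used only for elements of `𝒜⁺`). -/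
def wordLength (x : M.ArtinGroup) : ℕ :=
  sInf {n | ∃ ω : List B, ω.length = n ∧ M.positiveWord ω = x}

theorem artinRelations_lift (r : FreeGroup B) (hr : r ∈ M.artinRelations) :
    FreeGroup.lift M.simple r = 1 := by
  obtain ⟨i, j, rfl⟩ := hr
  have key : ∀ ω : List B, FreeGroup.lift M.simple (ω.map FreeGroup.of).prod
      = M.toCoxeterSystem.wordProd ω := by
    intro ω
    rw [map_list_prod, List.map_map, CoxeterSystem.wordProd]
    congr 1
  rw [map_mul, map_inv, key, key, mul_inv_eq_one]
  exact M.toCoxeterSystem.wordProd_braidWord_eq i j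

/-- The natural homomorphism `π : 𝒜 → 𝒲`, `s ↦ s`. -/
def artinProj : M.ArtinGroup →* M.Group := PresentedGroup.toGroup M.artinRelations_lift

/-- `x < y` in the sense of Deligne: `y = x z` for some positive `z` (a reflexive relation). -/
def Prefix (x y : M.ArtinGroup) : Prop := ∃ z ∈ M.artinMonoid, y = x * z

/-- Atoms: the elements `A` of `𝒜⁺` whose word-length in `𝒜⁺` equals the word-length of `π(A)`
in the Coxeter group. -/
def IsArtinAtom (A : M.ArtinGroup) : Prop :=
  A ∈ M.artinMonoid ∧ M.wordLength A = M.toCoxeterSystem.length (M.artinProj A)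

theorem artinProj_positiveWord (ω : List B) :
    M.artinProj (M.positiveWord ω) = M.toCoxeterSystem.wordProd ω := by
  rw [positiveWord, map_list_prod, List.map_map, CoxeterSystem.wordProd]
  congr 1

theorem positiveWord_mem (ω : List B) : M.positiveWord ω ∈ M.artinMonoid := by
  apply Submonoid.list_prod_mem
  intro x hx
  obtain ⟨i, -, rfl⟩ := List.mem_map.1 hx
  exact Submonoid.subset_closure ⟨i, rfl⟩

theorem exists_atom_artinProj_eq (w : M.Group) : ∃ A, M.IsArtinAtom A ∧ M.artinProj A = w := by
  obtain ⟨ω, hω, rfl⟩ := M.toCoxeterSystem.exists_isReduced w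
  refine ⟨M.positiveWord ω, ⟨M.positiveWord_mem ω, le_antisymm ?_ ?_⟩,
    M.artinProj_positiveWord ω⟩
  · rw [M.artinProj_positiveWord, hω]
    exact Nat.sInf_le ⟨ω, rfl, rfl⟩
  · obtain ⟨ω', h1, h2⟩ := Nat.sInf_mem
      (⟨ω.length, ω, rfl, rfl⟩ :
        {n | ∃ ω' : List B, ω'.length = n ∧ M.positiveWord ω' = M.positiveWord ω}.Nonempty)
    rw [← h2, M.artinProj_positiveWord]
    refine (M.toCoxeterSystem.length_wordProd_le ω').trans ?_
    rw [h2]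
    exact h1.le

theorem exists_garside [Finite M.Group] : ∃ D, M.IsArtinAtom D ∧
    ∀ w, M.toCoxeterSystem.length w ≤ M.toCoxeterSystem.length (M.artinProj D) := by
  obtain ⟨w₀, hw₀⟩ := Finite.exists_max M.toCoxeterSystem.length
  obtain ⟨D, hD, rfl⟩ := M.exists_atom_artinProj_eq w₀
  exact ⟨D, hD, hw₀⟩

/-- The element `Δ`: the atom that corresponds to the longest element of the (finite) Coxeter
group. -/
def garside [Finite M.Group] : M.ArtinGroup := M.exists_garside.choose

theorem garside_spec [Finite M.Group] : M.IsArtinAtom M.garside ∧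
    ∀ w, M.toCoxeterSystem.length w ≤ M.toCoxeterSystem.length (M.artinProj M.garside) :=
  M.exists_garside.choose_spec

/-- `A = α(g)`: the largest atom `A` with `A < g`. -/
def IsAlpha (g A : M.ArtinGroup) : Prop :=
  M.IsArtinAtom A ∧ M.Prefix A g ∧ ∀ A', M.IsArtinAtom A' → M.Prefix A' g → M.Prefix A' A

/-- The list `[A₁, …, A_k]` is a left greedy normal form (of its product): all `A_i` are
nontrivial atoms and `A_i = α(A_i A_{i+1} ⋯ A_k)` for all `i`. -/
def IsNormalForm : List M.ArtinGroup → Prop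
  | [] => True
  | A :: L => A ≠ 1 ∧ M.IsAlpha (A :: L).prod A ∧ IsNormalForm L

variable [Finite M.Group]

/-- The vertex set `V = 𝒜/⟨Δ⟩` of the complex `X(𝒢)`. -/
abbrev Vertex : Type _ := M.ArtinGroup ⧸ Subgroup.zpowers M.garside

/-- The basepoint `* = ⟨Δ⟩`. -/
def basepoint : M.Vertex := ((1 : M.ArtinGroup) : M.Vertex)

/-- `L` is the normal form, not involving `Δ`, of a representative of the vertex `v`. -/
def IsSpecialForm (v : M.Vertex) (L : List M.ArtinGroup) : Prop :=
  M.IsNormalForm L ∧ M.garside ∉ L ∧ (L.prod : M.Vertex) = v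

open Classical in
/-- The normal form of the special representative of the vertex `v`, i.e. of the unique
representative in `𝒜⁺` whose normal form has no `Δ`'s. (Every vertex has exactly one special
form, so the `else` branch never occurs.) -/
def specialForm (v : M.Vertex) : List M.ArtinGroup :=
  if h : ∃ L, M.IsSpecialForm v L then h.choose else []

/-- The atomnorm `|v|`: the number of atoms in the normal form of the special representative. -/
def atomNorm (v : M.Vertex) : ℕ := (M.specialForm v).length

/-- The wordnorm `‖v‖`: the word-length of the special representative. -/
def wordNorm (v : M.Vertex) : ℕ := M.wordLength (M.specialForm v).prod

/-- The atomdistance `d_at`: the left-invariant function with `d_at(*, v) = |v|`, that is,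
`d_at(g*, w) = |g⁻¹ w|` (the value does not depend on the representative `g`). -/
def atomDist (v w : M.Vertex) : ℕ := M.atomNorm (v.out⁻¹ • w)

/-- The worddistance `d_wd`: the left-invariant function with `d_wd(*, v) = ‖v‖`, that is,
`d_wd(g*, w) = ‖g⁻¹ w‖` (the value does not depend on the representative `g`). -/
def wordDist (v w : M.Vertex) : ℕ := M.wordNorm (v.out⁻¹ • w)

/-- The canonical edge-path `*, B₁, B₁B₂, …, B₁B₂⋯B_k = v` from the basepoint to `v`, where
`B₁ · B₂ · ⋯ · B_k` is the normal form of the special representative of `v`. -/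
def combing (v : M.Vertex) : List M.Vertex :=
  (M.specialForm v).inits.map fun L => (L.prod : M.Vertex)

/-- The list of vertices `γ` is the geodesic from `v` to `w`: the translate by some `g ∈ 𝒜` with
`g * = v` of the canonical path from `*` to `g⁻¹ w`. -/
def IsGeodesic (v w : M.Vertex) (γ : List M.Vertex) : Prop :=
  ∃ g : M.ArtinGroup, g • M.basepoint = v ∧
    γ = (M.combing (g⁻¹ • w)).map fun x => g • x

end

end CoxeterMatrix

/-!
All distances are read off from representatives. If `k` and `h` represent the vertices `u` and `p`
and `x = k⁻¹ * h` is special, that is, positive and not divisible by `Δ`, then `d_wd(u, p)` is the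
word-length of `x` and `d_at(u, p)` is the least `n` such that `x` divides `Δ ^ n`
(`CoxeterMatrix.wordDist_eq`, `CoxeterMatrix.atomDist_le_iff`). Let the geodesic from `v` to `w`
be given by a normal form `L₁ ++ L₂` without `Δ`, with `p` reached after `L₁`. Then `v` and `w`
are represented by `h * P` and `h * Q`, where `Q` is the product of `L₂` and `P` is the positive
element that completes the product of `L₁` to `Δ ^ L₁.length`. If one of `x * P` and `x * Q` is
not divisible by `Δ`, then it is the special representative of its vertex as seen from `u`. As it
extends `x`, the atom distance does not drop, and the word distance grows by the word-length of
`P` or `Q`, which is at least the number of atoms in that half of the geodesic.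

So the theorem reduces to `CoxeterMatrix.not_prefix_of_isNormalForm`: `Δ` cannot divide both
`x * P` and `x * Q`. The atoms `r` such that `Δ` divides `x * r` are closed under common prefixes
(`CoxeterMatrix.exists_common_prefix`), so otherwise `P` and `Q` would share a nontrivial prefix
`r`. Since `r` is a prefix of `Q`, the list `L₁ ++ [r]` is again a normal form, with one atom more
than `L₁`; since `r` is a prefix of `P`, its product divides `Δ ^ L₁.length`, which only allows
normal forms with at most `L₁.length` atoms.

The normal form theory behind this is obtained as follows. The contragredient geometric
representation shows that `s_i s_j` has order `M i j`, and the sign action on reflections gives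
the exchange condition; both together describe dihedral cosets and yield Matsumoto's theorem
(`CoxeterSystem.IsReduced.map_prod_eq`), which lifts the Coxeter group to the atoms. A diamond
lemma in the weak order (`CoxeterSystem.exists_greatest`) gives meets, and for `x`, `y` the
greatest prefix `t` of `y` that `x` can absorb. The resulting factors `head x y = x * t` and
`tail x y = t⁻¹ * y` satisfy two associativity identities (`CoxeterSystem.head_mul`,
`CoxeterSystem.tail_mul`), which say that multiplying from left to right through a sequence of
group elements is an action of the atoms on normal sequences. In this action the longest element
acts injectively, since it prepends itself, and its square is central, so the action extends,
after localization, to the Artin group. Hence positive words that agree in the Artin *group* act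
in the same way (`CoxeterMatrix.normalMul_prod_eq`), and the image of the constant sequence `1` is
a well-defined normal form whose first entry is the greatest atom dividing the element. No
separate proof that the Artin monoid embeds in the Artin group is needed.
-/

/-! ### The order of a product of two simple reflections -/

namespace CoxeterMatrix

variable {B : Type*} (M : CoxeterMatrix B)

/-- The reflection of `B → ℝ` attached to `i` by the contragredient of the geometric
representation: for `f` thought of as a linear form on the space with basis `(e_j)`, the value on
`e_j` of the image is `f j - 2 * f i * ⟪e_i, e_j⟫`, where `⟪e_i, e_j⟫ = -cos (π / M i j)`. The
junk value `π / 0 = 0` yields the correct `-1` for `M i j = 0`, that is, for `m = ∞`. -/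
noncomputable def dualReflection (i : B) : Module.End ℝ (B → ℝ) where
  toFun f := fun j => f j + 2 * f i * Real.cos (Real.pi / M i j)
  map_add' f g := by ext j; simp; ring
  map_smul' c f := by ext j; simp; ring

theorem dualReflection_apply (i : B) (f : B → ℝ) (j : B) :
    M.dualReflection i f j = f j + 2 * f i * Real.cos (Real.pi / M i j) := rfl

/-- The linear form dual to the simple root of index `i` under the invariant form. -/
noncomputable def dualRoot (i : B) : B → ℝ := fun j => -Real.cos (Real.pi / M i j)

theorem dualRoot_self (i : B) : M.dualRoot i i = 1 := by
  simp [dualRoot]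

theorem dualReflection_eq (i : B) (f : B → ℝ) :
    M.dualReflection i f = f - (2 * f i) • M.dualRoot i := by
  ext j
  simp [dualReflection_apply, dualRoot]

theorem dualReflection_mul_self (i : B) : M.dualReflection i * M.dualReflection i = 1 := by
  ext f j
  simp [dualReflection_apply]
  ring

/-- The rotation `σ_i σ_j` in the plane spanned by the two dual roots. The factor `sin θ` on the
left avoids a division. -/
theorem sin_smul_pow_dualRoot (i j : B) (k : ℕ) :
    Real.sin (Real.pi / M i j) •
        ((M.dualReflection i * M.dualReflection j) ^ k) (M.dualRoot i) =
      Real.sin ((2 * k + 1) * (Real.pi / M i j)) • M.dualRoot i +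
        Real.sin (2 * k * (Real.pi / M i j)) • M.dualRoot j := by
  induction k with
  | zero => simp
  | succ k ih =>
    rw [pow_succ', Module.End.mul_apply, ← map_smul, ih, map_add, map_smul, map_smul,
      Module.End.mul_apply, Module.End.mul_apply]
    have hj : M.dualRoot i j = -Real.cos (Real.pi / M i j) := rfl
    have hi : M.dualRoot j i = -Real.cos (Real.pi / M i j) := by rw [dualRoot, M.symmetric]
    simp only [dualReflection_eq, Pi.sub_apply, Pi.smul_apply, smul_eq_mul, dualRoot_self, hi, hj]
    set θ := Real.pi / (M i j : ℝ)
    have e1 : Real.sin ((2 * ((k + 1 : ℕ) : ℝ) + 1) * θ) =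
        Real.sin ((2 * k + 1) * θ) * (4 * Real.cos θ ^ 2 - 1) -
          Real.sin (2 * k * θ) * (2 * Real.cos θ) := by
      rw [show (2 * ((k + 1 : ℕ) : ℝ) + 1) * θ = 2 * k * θ + θ + θ + θ by push_cast; ring,
        show (2 * k + 1) * θ = 2 * k * θ + θ by ring]
      simp only [Real.sin_add, Real.cos_add]
      have := Real.sin_sq_add_cos_sq θ
      linear_combination
        (-3 * Real.sin (2 * k * θ) * Real.cos θ - Real.cos (2 * k * θ) * Real.sin θ) * this
    have e2 : Real.sin (2 * ((k + 1 : ℕ) : ℝ) * θ) =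
        Real.sin ((2 * k + 1) * θ) * (2 * Real.cos θ) - Real.sin (2 * k * θ) := by
      rw [show 2 * ((k + 1 : ℕ) : ℝ) * θ = 2 * k * θ + θ + θ by push_cast; ring,
        show (2 * k + 1) * θ = 2 * k * θ + θ by ring]
      simp only [Real.sin_add, Real.cos_add]
      have := Real.sin_sq_add_cos_sq θ
      linear_combination (- Real.sin (2 * k * θ)) * this
    rw [e1, e2]
    ext l
    simp only [Pi.add_apply, Pi.sub_apply, Pi.smul_apply, smul_eq_mul]
    ring

theorem sin_pi_div_ne_zero {m : ℕ} (hm : 2 ≤ m) : Real.sin (Real.pi / m) ≠ 0 := by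
  have h2 : (2 : ℝ) ≤ m := by exact_mod_cast hm
  refine (Real.sin_pos_of_pos_of_lt_pi (by positivity) ?_).ne'
  rw [div_lt_iff₀ (by positivity)]
  nlinarith [Real.pi_pos]

theorem two_le_of_ne {i j : B} (hij : i ≠ j) (h0 : M i j ≠ 0) : 2 ≤ M i j := by
  have := M.off_diagonal i j hij
  omega

theorem pow_dualRoot_left {i j : B} (hij : i ≠ j) (h0 : M i j ≠ 0) :
    ((M.dualReflection i * M.dualReflection j) ^ M i j) (M.dualRoot i) = M.dualRoot i := by
  have hs := sin_pi_div_ne_zero (M.two_le_of_ne hij h0)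
  have h := M.sin_smul_pow_dualRoot i j (M i j)
  have hm : (M i j : ℝ) ≠ 0 := by exact_mod_cast h0
  rw [show (2 * (M i j : ℝ) + 1) * (Real.pi / M i j) = Real.pi / M i j + 2 * Real.pi by
      field_simp; ring,
    show 2 * (M i j : ℝ) * (Real.pi / M i j) = 2 * Real.pi by field_simp,
    Real.sin_add_two_pi, Real.sin_two_pi, zero_smul, add_zero] at h
  exact smul_right_injective _ hs h

theorem isLiftable_dualReflection : M.IsLiftable M.dualReflection := by
  intro i j
  rcases eq_or_ne i j with rfl | hij
  · simp [dualReflection_mul_self]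
  rcases eq_or_ne (M i j) 0 with h0 | h0
  · simp [h0]
  set ρ := (M.dualReflection i * M.dualReflection j) ^ M i j with hρ
  have hs := sin_pi_div_ne_zero (M.two_le_of_ne hij h0)
  have hi : ρ (M.dualRoot i) = M.dualRoot i := M.pow_dualRoot_left hij h0
  have hj : ρ (M.dualRoot j) = M.dualRoot j := by
    have hinv : ρ * (M.dualReflection j * M.dualReflection i) ^ M i j = 1 := by
      have h2 : (M.dualReflection i * M.dualReflection j) *
          (M.dualReflection j * M.dualReflection i) = 1 := by
        rw [mul_assoc, ← mul_assoc (M.dualReflection j), dualReflection_mul_self, one_mul,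
          dualReflection_mul_self]
      have h1 : (M.dualReflection j * M.dualReflection i) *
          (M.dualReflection i * M.dualReflection j) = 1 := by
        rw [mul_assoc, ← mul_assoc (M.dualReflection i), dualReflection_mul_self, one_mul,
          dualReflection_mul_self]
      rw [hρ, ← (show Commute _ _ from h2.trans h1.symm).mul_pow, h2, one_pow]
    have h := M.pow_dualRoot_left hij.symm (by rwa [M.symmetric])
    rw [M.symmetric j i] at h
    calc ρ (M.dualRoot j) = ρ (((M.dualReflection j * M.dualReflection i) ^ M i j)
          (M.dualRoot j)) := by rw [h]
      _ = (ρ * (M.dualReflection j * M.dualReflection i) ^ M i j) (M.dualRoot j) := rfl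
      _ = _ := by rw [hinv]; rfl
  -- Forms vanishing at `i` and `j` are fixed; they span a complement of the two dual roots.
  have hfix : ∀ f : B → ℝ, f i = 0 → f j = 0 → ρ f = f := by
    intro f fi fj
    have h1 : (M.dualReflection i * M.dualReflection j) f = f := by
      rw [Module.End.mul_apply, dualReflection_eq M j, fj]
      simp [dualReflection_eq, fi]
    rw [hρ]
    generalize M i j = n
    induction n with
    | zero => rfl
    | succ n ih => rw [pow_succ, Module.End.mul_apply, h1, ih]
  refine LinearMap.ext fun f => ?_
  rw [Module.End.one_apply]
  set θ := Real.pi / (M i j : ℝ) with hθ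
  have hji : M.dualRoot i j = -Real.cos θ := rfl
  have hij' : M.dualRoot j i = -Real.cos θ := by rw [dualRoot, M.symmetric]
  set x := (f i + Real.cos θ * f j) / Real.sin θ ^ 2 with hx
  set y := (f j + Real.cos θ * f i) / Real.sin θ ^ 2 with hy
  have hsq : Real.sin θ ^ 2 = 1 - Real.cos θ ^ 2 := Real.sin_sq θ
  have hs2 : (1 - Real.cos θ ^ 2) ≠ 0 := by rw [← hsq]; exact pow_ne_zero 2 hs
  have h1 := hfix (f - x • M.dualRoot i - y • M.dualRoot j)
    (by simp only [Pi.sub_apply, Pi.smul_apply, smul_eq_mul, dualRoot_self, hij', hx, hy, hsq]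
        field_simp; ring)
    (by simp only [Pi.sub_apply, Pi.smul_apply, smul_eq_mul, dualRoot_self, hji, hx, hy, hsq]
        field_simp; ring)
  rw [map_sub, map_sub, map_smul, map_smul, hi, hj] at h1
  simpa using h1

end CoxeterMatrix

namespace CoxeterSystem

variable {B W : Type*} [Group W] {M : CoxeterMatrix B}

/-- Together with the defining relations this says that the product of two simple reflections has
order exactly `M i j`, where `0` stands for infinite order. -/
theorem dvd_of_simple_mul_simple_pow_eq_one (cs : CoxeterSystem M W) {i j : B} (hij : i ≠ j) {k : ℕ}
    (hk : (cs.simple i * cs.simple j) ^ k = 1) : M i j ∣ k := by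
  have h : (M.dualReflection i * M.dualReflection j) ^ k = 1 := by
    have := congrArg (cs.lift ⟨_, M.isLiftable_dualReflection⟩) hk
    simpa only [map_pow, map_mul, lift_apply_simple, map_one] using this
  rcases eq_or_ne (M i j) 0 with h0 | h0
  · -- For `m = ∞` the product acts on the values at `i` and `j` as a transvection.
    have key : ∀ (n : ℕ) (f : B → ℝ), f i + f j = 1 →
        (((M.dualReflection i * M.dualReflection j) ^ n) f) j = f j + 2 * n ∧
        (((M.dualReflection i * M.dualReflection j) ^ n) f) i +
          (((M.dualReflection i * M.dualReflection j) ^ n) f) j = 1 := by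
      intro n f hf
      induction n with
      | zero => simp [hf]
      | succ n ih =>
        rw [pow_succ', Module.End.mul_apply]
        have h0' : M j i = 0 := by rw [M.symmetric, h0]
        simp only [Module.End.mul_apply, CoxeterMatrix.dualReflection_apply, h0, h0',
          M.diagonal]
        push_cast
        simp only [div_zero, div_one, Real.cos_zero, Real.cos_pi]
        constructor <;> linarith [ih.1, ih.2]
    classical
    have := (key k (Pi.single i 1) (by simp [hij.symm])).1
    rw [h] at this
    simp [hij.symm] at this
    simp [this]
  · have hs := CoxeterMatrix.sin_pi_div_ne_zero (M.two_le_of_ne hij h0)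
    have h1 := congrFun (M.sin_smul_pow_dualRoot i j k) i
    have hij' : M.dualRoot j i = -Real.cos (Real.pi / M i j) := by
      rw [CoxeterMatrix.dualRoot, M.symmetric]
    simp only [h, Module.End.one_apply, Pi.add_apply, Pi.smul_apply, smul_eq_mul,
      CoxeterMatrix.dualRoot_self, hij'] at h1
    rw [add_mul, one_mul, Real.sin_add] at h1
    have hc : Real.cos (2 * k * (Real.pi / M i j)) = 1 := by
      have : Real.sin (Real.pi / M i j) * Real.cos (2 * k * (Real.pi / M i j)) =
        Real.sin (Real.pi / M i j) * 1 := by linarith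
      exact mul_left_cancel₀ hs this
    obtain ⟨n, hn⟩ := (Real.cos_eq_one_iff _).1 hc
    have hm : (M i j : ℝ) ≠ 0 := by exact_mod_cast h0
    have : (n : ℝ) * M i j = k := by
      field_simp at hn
      nlinarith [Real.pi_pos, hn]
    have h2 : n * (M i j : ℤ) = k := by exact_mod_cast this
    exact Int.natCast_dvd_natCast.1 ⟨n, by rw [← h2, mul_comm]⟩

theorem coxeterMatrix_ne_zero [Finite W] (cs : CoxeterSystem M W) (i j : B) : M i j ≠ 0 := by
  intro h0
  rcases eq_or_ne i j with rfl | hij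
  · simp at h0
  have hp := orderOf_pos (cs.simple i * cs.simple j)
  have := cs.dvd_of_simple_mul_simple_pow_eq_one hij (pow_orderOf_eq_one _)
  rw [h0, zero_dvd_iff] at this
  omega

end CoxeterSystem

/-! ### Exchange condition, dihedral cosets and Matsumoto's theorem -/

namespace CoxeterSystem

variable {B W : Type*} [Group W] {M : CoxeterMatrix B} (cs : CoxeterSystem M W)

open Classical in
/-- The action of a simple reflection on pairs of a group element and a sign (written additively in
`ZMod 2`): conjugate the element, and change the sign when the element is the reflection itself. -/
noncomputable def signedConj (i : B) : Function.End (W × ZMod 2) := fun p =>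
  (cs.simple i * p.1 * cs.simple i, p.2 + if p.1 = cs.simple i then 1 else 0)

open Classical in
theorem prod_signedConj_apply (ω : List B) (t : W) (ε : ZMod 2) :
    (ω.map cs.signedConj).prod (t, ε) =
      (cs.wordProd ω * t * (cs.wordProd ω)⁻¹, ε + ((cs.rightInvSeq ω).count t : ℕ)) := by
  induction ω with
  | nil => simp [Function.End.one_def]
  | cons i ω ih =>
    rw [List.map_cons, List.prod_cons]
    change cs.signedConj i ((ω.map cs.signedConj).prod (t, ε)) = _
    rw [ih, signedConj]
    simp only [wordProd_cons, mul_inv_rev, inv_simple, mul_assoc, rightInvSeq, List.count_cons]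
    have : (cs.wordProd ω * (t * (cs.wordProd ω)⁻¹) = cs.simple i) ↔
        ((cs.wordProd ω)⁻¹ * (cs.simple i * cs.wordProd ω) = t) := by
      constructor
      · intro h; rw [← h]; group
      · intro h; rw [← h]; group
    simp only [this, beq_iff_eq, Nat.cast_add, Nat.cast_ite, Nat.cast_one, Nat.cast_zero, add_assoc]

theorem map_alternatingWord_two_mul {G : Type*} [Monoid G] (f : B → G) (i j : B) (m : ℕ) :
    ((alternatingWord i j (2 * m)).map f).prod = (f i * f j) ^ m := by
  induction m with
  | zero => simp [alternatingWord]
  | succ m ih =>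
    rw [show 2 * (m + 1) = 2 * m + 1 + 1 by ring, alternatingWord_succ, alternatingWord_succ,
      pow_succ, ← ih]
    simp

theorem rightInvSeq_alternatingWord (i j : B) (n : ℕ) :
    cs.rightInvSeq (alternatingWord i j n) =
      ((List.range n).map fun k => cs.simple j * (cs.simple i * cs.simple j) ^ k).reverse := by
  induction n generalizing i j with
  | zero => rfl
  | succ n ih =>
    rw [alternatingWord_succ, rightInvSeq_concat, ih, List.range_succ_eq_map, List.map_cons,
      List.reverse_cons, List.map_reverse, List.concat_eq_append, pow_zero, mul_one, List.map_map,
      List.map_map]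
    congr 2
    refine List.map_congr_left fun k _ => ?_
    have h : (cs.simple j * cs.simple i) ^ k * cs.simple j =
        cs.simple j * (cs.simple i * cs.simple j) ^ k :=
      ((SemiconjBy.pow_right (show SemiconjBy (cs.simple j) (cs.simple i * cs.simple j)
        (cs.simple j * cs.simple i) by simp [SemiconjBy, mul_assoc])) k).symm
    simp only [Function.comp_apply, MulAut.conj_apply, inv_simple, Nat.succ_eq_add_one, pow_succ']
    rw [mul_assoc, mul_assoc, h]
    simp only [mul_assoc]

theorem isLiftable_signedConj : M.IsLiftable cs.signedConj := by
  classical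
  intro i j
  rw [← map_alternatingWord_two_mul]
  funext p
  obtain ⟨t, ε⟩ := p
  have h1 : cs.wordProd (alternatingWord i j (2 * M i j)) = 1 := by
    rw [wordProd, map_alternatingWord_two_mul, simple_mul_simple_pow]
  rw [prod_signedConj_apply, h1, rightInvSeq_alternatingWord, List.count_reverse, two_mul,
    List.range_add, List.map_append, List.count_append, List.map_map]
  have h2 : (fun k => cs.simple j * (cs.simple i * cs.simple j) ^ k) ∘ (fun k => M i j + k) =
      fun k => cs.simple j * (cs.simple i * cs.simple j) ^ k := by
    funext k
    simp [pow_add]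
  rw [h2, Nat.cast_add, CharTwo.add_self_eq_zero]
  simp [Function.End.one_def]

open Classical in
/-- The parity of the number of times a reflection occurs in the inversion sequence of a word
depends only on the product of the word. -/
theorem count_rightInvSeq_eq {ω ω' : List B} (h : cs.wordProd ω = cs.wordProd ω') (t : W) :
    ((cs.rightInvSeq ω).count t : ZMod 2) = ((cs.rightInvSeq ω').count t : ℕ) := by
  have key : ∀ ω : List B, (ω.map cs.signedConj).prod =
      cs.lift ⟨_, cs.isLiftable_signedConj⟩ (cs.wordProd ω) := by
    intro ω
    rw [wordProd, map_list_prod, List.map_map]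
    congr 1
    refine List.map_congr_left fun i _ => ?_
    rw [Function.comp_apply, lift_apply_simple]
  have h1 := congrFun ((key ω).trans ((congrArg _ h).trans (key ω').symm)) (t, 0)
  rw [prod_signedConj_apply, prod_signedConj_apply] at h1
  simpa using (Prod.ext_iff.1 h1).2

theorem mem_rightInvSeq_of_nodup {ω ω' : List B} (h : cs.wordProd ω = cs.wordProd ω')
    (hω : (cs.rightInvSeq ω).Nodup) {t : W} (ht : t ∈ cs.rightInvSeq ω) :
    t ∈ cs.rightInvSeq ω' := by
  classical
  have h1 := cs.count_rightInvSeq_eq h t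
  rw [List.count_eq_one_of_mem hω ht] at h1
  by_contra hn
  rw [List.count_eq_zero_of_not_mem hn] at h1
  simp at h1

theorem isReduced_of_nodup_rightInvSeq {ω : List B} (hω : (cs.rightInvSeq ω).Nodup) :
    cs.IsReduced ω := by
  obtain ⟨ω', h', h⟩ := cs.exists_isReduced (cs.wordProd ω)
  refine le_antisymm (cs.length_wordProd_le ω) ?_
  rw [h, h'.eq, ← cs.length_rightInvSeq, ← cs.length_rightInvSeq ω']
  exact (hω.subperm fun t ht => cs.mem_rightInvSeq_of_nodup h hω ht).length_le

/-- The exchange condition. -/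
theorem exists_eraseIdx_of_isRightDescent {ω : List B} {i : B}
    (h : cs.IsRightDescent (cs.wordProd ω) i) :
    ∃ n < ω.length, cs.wordProd ω * cs.simple i = cs.wordProd (ω.eraseIdx n) := by
  obtain ⟨ω', h', e⟩ := cs.exists_isReduced (cs.wordProd ω * cs.simple i)
  have e1 : cs.wordProd (ω'.concat i) = cs.wordProd ω := by
    rw [wordProd_concat, ← e, simple_mul_simple_cancel_right]
  have hred : cs.IsReduced (ω'.concat i) := by
    have h1 := (cs.isRightDescent_iff).1 h
    rw [IsReduced, e1, ← h1, e, h'.eq, List.length_concat]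
  have hmem : cs.simple i ∈ cs.rightInvSeq ω :=
    cs.mem_rightInvSeq_of_nodup e1 hred.nodup_rightInvSeq (by
      rw [rightInvSeq_concat, List.concat_eq_append]; simp)
  obtain ⟨n, hn, hni⟩ := List.mem_iff_getElem.1 hmem
  refine ⟨n, by simpa using hn, ?_⟩
  rw [← cs.wordProd_mul_getD_rightInvSeq, List.getD_eq_getElem _ _ hn, hni]

theorem isReduced_alternatingWord {i j : B} (hij : i ≠ j) {k : ℕ} (hk : k ≤ M i j) :
    cs.IsReduced (alternatingWord i j k) := by
  refine cs.isReduced_of_nodup_rightInvSeq ?_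
  rw [rightInvSeq_alternatingWord, List.nodup_reverse]
  refine List.Nodup.map_on ?_ List.nodup_range
  have key : ∀ a b : ℕ, a < b → b < k → (cs.simple i * cs.simple j) ^ a ≠
      (cs.simple i * cs.simple j) ^ b := by
    intro a b hab hb h
    obtain ⟨c, rfl⟩ := Nat.exists_eq_add_of_lt hab
    rw [add_assoc, pow_add, left_eq_mul] at h
    have := Nat.le_of_dvd (by omega) (cs.dvd_of_simple_mul_simple_pow_eq_one hij h)
    omega
  intro a ha b hb hab
  have hab := mul_left_cancel hab
  rw [List.mem_range] at ha hb
  rcases lt_trichotomy a b with h | h | h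
  · exact (key a b h hb hab).elim
  · exact h
  · exact (key b a h ha hab.symm).elim

/-- Every element of the dihedral subgroup generated by two simple reflections is an alternating
product of at most `M i j` factors. -/
theorem exists_alternatingWord_eq {i j : B} (h0 : M i j ≠ 0) (ω : List B)
    (hω : ∀ x ∈ ω, x = i ∨ x = j) : ∃ k ≤ M i j,
      cs.wordProd ω = cs.wordProd (alternatingWord i j k) ∨
      cs.wordProd ω = cs.wordProd (alternatingWord j i k) := by
  have step : ∀ (i j : B) (k : ℕ), M i j ≠ 0 → k ≤ M i j → ∀ x, (x = i ∨ x = j) → ∃ l ≤ M i j,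
      cs.wordProd (alternatingWord i j k) * cs.simple x = cs.wordProd (alternatingWord i j l) ∨
      cs.wordProd (alternatingWord i j k) * cs.simple x = cs.wordProd (alternatingWord j i l) := by
    rintro i j k h0 hk x (rfl | rfl)
    · rcases hk.lt_or_eq with hk | rfl
      · exact ⟨k + 1, hk, Or.inr (by rw [alternatingWord_succ, wordProd_concat])⟩
      · obtain ⟨m, hm⟩ := Nat.exists_eq_succ_of_ne_zero h0
        refine ⟨m, by omega, Or.inl ?_⟩
        have := cs.wordProd_braidWord_eq x j
        rw [this, braidWord, M.symmetric j x, hm, Nat.succ_eq_add_one, alternatingWord_succ,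
          wordProd_concat, simple_mul_simple_cancel_right]
    · cases k with
      | zero => exact ⟨1, by omega, Or.inl (by simp [alternatingWord])⟩
      | succ k => exact ⟨k, by omega, Or.inr (by
          rw [alternatingWord_succ, wordProd_concat, simple_mul_simple_cancel_right])⟩
  induction ω using List.reverseRecOn with
  | nil => exact ⟨0, by omega, Or.inl rfl⟩
  | append_singleton ω x ih =>
    obtain ⟨k, hk, h⟩ := ih fun y hy => hω y (by simp [hy])
    have hx := hω x (by simp)
    rw [wordProd_append, wordProd_singleton]
    rcases h with h | h
    · rw [h]; exact step i j k h0 hk x hx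
    · rw [h]
      obtain ⟨l, hl, h⟩ := step j i k (by rwa [M.symmetric]) (by rwa [M.symmetric]) x hx.symm
      exact ⟨l, by rwa [M.symmetric], h.symm⟩

/-- `v` has minimal length in its left coset of the dihedral subgroup generated by `i` and `j`. -/
def IsDihedralMin (i j : B) (v : W) : Prop :=
  ∀ ω : List B, (∀ x ∈ ω, x = i ∨ x = j) → cs.length v ≤ cs.length (v * cs.wordProd ω)

variable {cs} in
theorem IsDihedralMin.symm {i j : B} {v : W} (h : cs.IsDihedralMin i j v) :
    cs.IsDihedralMin j i v := fun ω hω => h ω fun x hx => (hω x hx).symm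

theorem mem_alternatingWord {i j : B} {k : ℕ} {x : B} (hx : x ∈ alternatingWord i j k) :
    x = i ∨ x = j := by
  induction k generalizing i j with
  | zero => simp [alternatingWord] at hx
  | succ k ih =>
    rw [alternatingWord_succ, List.concat_eq_append, List.mem_append, List.mem_singleton] at hx
    rcases hx with hx | hx
    · exact (ih hx).symm
    · exact Or.inr hx

variable {cs} in
theorem IsDihedralMin.length_mul {i j : B} (hij : i ≠ j) {v : W} (h : cs.IsDihedralMin i j v)
    {k : ℕ} (hk : k ≤ M i j) :
    cs.length (v * cs.wordProd (alternatingWord i j k)) = cs.length v + k := by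
  induction k generalizing i j with
  | zero => simp [alternatingWord]
  | succ k ih =>
    have ih := ih hij.symm h.symm (by rw [M.symmetric]; omega)
    rw [alternatingWord_succ, wordProd_concat, ← mul_assoc]
    rcases cs.length_mul_simple (v * cs.wordProd (alternatingWord j i k)) j with h1 | h1
    · rw [h1, ih, add_assoc]
    exfalso
    obtain ⟨ρ, hρ, rfl⟩ := cs.exists_isReduced v
    rw [← wordProd_append] at h1
    obtain ⟨n, hn, he⟩ := cs.exists_eraseIdx_of_isRightDescent (ω := ρ ++ alternatingWord j i k)
      (i := j) (by rw [IsRightDescent]; omega)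
    rw [List.length_append, length_alternatingWord] at hn
    by_cases hnρ : n < ρ.length
    · -- A letter of `v` is deleted: this gives a shorter element of the coset.
      rw [List.eraseIdx_append_of_lt_length hnρ, wordProd_append, wordProd_append] at he
      have h2 := h ((alternatingWord j i k).concat j ++ (alternatingWord j i k).reverse) (by
        intro x hx
        simp only [List.concat_eq_append, List.mem_append, List.mem_singleton,
          List.mem_reverse] at hx
        rcases hx with (hx | hx) | hx
        · exact (mem_alternatingWord hx).symm
        · exact Or.inr hx
        · exact (mem_alternatingWord hx).symm)
      rw [wordProd_append, wordProd_concat, wordProd_reverse, ← mul_assoc, ← mul_assoc, he,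
        mul_inv_cancel_right, hρ.eq] at h2
      have h3 := cs.length_wordProd_le (ρ.eraseIdx n)
      rw [List.length_eraseIdx_of_lt hnρ] at h3
      omega
    · -- A letter of the alternating word is deleted: this word would not be reduced.
      rw [List.eraseIdx_append_of_length_le (not_lt.1 hnρ), wordProd_append, wordProd_append,
        mul_assoc] at he
      have h2 := cs.isReduced_alternatingWord hij hk
      rw [alternatingWord_succ, IsReduced, wordProd_concat, mul_left_cancel he,
        List.length_concat, length_alternatingWord] at h2
      have h3 := cs.length_wordProd_le ((alternatingWord j i k).eraseIdx (n - ρ.length))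
      rw [h2, List.length_eraseIdx_of_lt (by rw [length_alternatingWord]; omega),
        length_alternatingWord] at h3
      omega

theorem exists_isDihedralMin (i j : B) (h0 : M i j ≠ 0) (u : W) :
    ∃ v, cs.IsDihedralMin i j v ∧ ∃ k ≤ M i j,
      u = v * cs.wordProd (alternatingWord i j k) ∨
      u = v * cs.wordProd (alternatingWord j i k) := by
  obtain ⟨v, ⟨ω, hω, rfl⟩, hmin⟩ := (measure cs.length).wf.has_min
    {v | ∃ ω : List B, (∀ x ∈ ω, x = i ∨ x = j) ∧ v = u * cs.wordProd ω} ⟨_, [], by simp, rfl⟩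
  refine ⟨_, fun ω' hω' => not_lt.1 (hmin _ ⟨ω ++ ω', ?_, ?_⟩), ?_⟩
  · intro x hx
    rcases List.mem_append.1 hx with hx | hx
    exacts [hω x hx, hω' x hx]
  · rw [wordProd_append, mul_assoc]
  · obtain ⟨k, hk, h⟩ := cs.exists_alternatingWord_eq h0 ω.reverse (by simpa using hω)
    refine ⟨k, hk, h.imp (fun h => ?_) fun h => ?_⟩ <;>
      rw [← h, wordProd_reverse, mul_inv_cancel_right]

theorem length_mul_braidWord {i j : B} (hij : i ≠ j) (h0 : M i j ≠ 0) {u : W}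
    (hi : ¬ cs.IsRightDescent u i) (hj : ¬ cs.IsRightDescent u j) :
    cs.length (u * cs.wordProd (braidWord M i j)) = cs.length u + M i j := by
  obtain ⟨v, hv, k, hk, h⟩ := cs.exists_isDihedralMin i j h0 u
  have key : ∀ (i j : B), i ≠ j → cs.IsDihedralMin i j v → k ≤ M i j →
      u = v * cs.wordProd (alternatingWord i j k) → ¬ cs.IsRightDescent u j → u = v := by
    rintro i j hij hv hk rfl hj
    cases k with
    | zero => simp [alternatingWord]
    | succ k =>
      refine (hj ?_).elim
      have h1 := hv.length_mul hij hk
      have h2 := hv.symm.length_mul hij.symm (k := k) (by rw [M.symmetric]; omega)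
      rw [IsRightDescent, h1, alternatingWord_succ, wordProd_concat, ← mul_assoc,
        simple_mul_simple_cancel_right, h2]
      omega
  have huv : u = v := by
    rcases h with h | h
    · exact key i j hij hv hk h hj
    · exact key j i hij.symm hv.symm (by rwa [M.symmetric]) h hi
  rw [huv]
  exact hv.length_mul hij le_rfl

theorem exists_eq_mul_braidWord {i j : B} (hij : i ≠ j) (h0 : M i j ≠ 0) {u : W}
    (hi : cs.IsRightDescent u i) (hj : cs.IsRightDescent u j) :
    ∃ v, u = v * cs.wordProd (braidWord M i j) ∧ cs.length u = cs.length v + M i j := by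
  obtain ⟨v, hv, k, hk, h⟩ := cs.exists_isDihedralMin i j h0 u
  have key : ∀ (i j : B), i ≠ j → cs.IsDihedralMin i j v → k ≤ M i j →
      u = v * cs.wordProd (alternatingWord i j k) → cs.IsRightDescent u i → k = M i j := by
    rintro i j hij hv hk rfl hi
    by_contra hne
    have h1 := hv.length_mul hij hk
    have h2 := hv.symm.length_mul hij.symm (k := k + 1) (by rw [M.symmetric]; omega)
    rw [alternatingWord_succ, wordProd_concat, ← mul_assoc] at h2
    rw [IsRightDescent, h1, h2] at hi
    omega
  have huv : u = v * cs.wordProd (braidWord M i j) := by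
    rcases h with h | h
    · rwa [key i j hij hv hk h hi] at h
    · have hk' : k = M j i := key j i hij.symm hv.symm (by rwa [M.symmetric]) h hj
      rw [hk'] at h
      rwa [cs.wordProd_braidWord_eq]
  exact ⟨v, huv, by rw [huv]; exact hv.length_mul hij le_rfl⟩

theorem length_braidWord {i j : B} (hij : i ≠ j) :
    cs.length (cs.wordProd (braidWord M i j)) = M i j := by
  rw [(cs.isReduced_alternatingWord hij le_rfl).eq, length_alternatingWord]

theorem inv_braidWord {i j : B} (hij : i ≠ j) (h0 : M i j ≠ 0) :
    (cs.wordProd (braidWord M i j))⁻¹ = cs.wordProd (braidWord M i j) := by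
  obtain ⟨k, hk, h⟩ := cs.exists_alternatingWord_eq h0 (braidWord M i j).reverse
    (fun x hx => mem_alternatingWord (List.mem_reverse.1 hx))
  rw [wordProd_reverse] at h
  have hl := cs.length_inv (cs.wordProd (braidWord M i j))
  rw [cs.length_braidWord hij] at hl
  rcases h with h | h
  · rw [h, (cs.isReduced_alternatingWord hij hk).eq, length_alternatingWord] at hl
    rw [h, hl]
  · rw [h, (cs.isReduced_alternatingWord hij.symm (by rwa [M.symmetric])).eq,
      length_alternatingWord] at hl
    rw [h, hl, cs.wordProd_braidWord_eq, braidWord, M.symmetric j i]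

/-- Matsumoto's theorem: a family satisfying the braid relations takes the same value on all
reduced words of a group element. -/
theorem IsReduced.map_prod_eq {G : Type*} [Monoid G] (hM : ∀ i j, M i j ≠ 0) (f : B → G)
    (hf : ∀ i j, ((braidWord M i j).map f).prod = ((braidWord M j i).map f).prod)
    {ω ω' : List B} (hω : cs.IsReduced ω) (hω' : cs.IsReduced ω')
    (h : cs.wordProd ω = cs.wordProd ω') : (ω.map f).prod = (ω'.map f).prod := by
  induction hn : ω.length generalizing ω ω' with
  | zero =>
    have h' : ω'.length = 0 := by rw [← hω'.eq, ← h, hω.eq, hn]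
    rw [List.length_eq_zero_iff.1 hn, List.length_eq_zero_iff.1 h']
  | succ n ih =>
    have hn' : ω'.length = n + 1 := by rw [← hω'.eq, ← h, hω.eq, hn]
    -- Words with the same last letter are compared by induction.
    have last : ∀ (i : B) (α β : List B), cs.IsReduced (α ++ [i]) → cs.IsReduced (β ++ [i]) →
        cs.wordProd (α ++ [i]) = cs.wordProd (β ++ [i]) → (α ++ [i]).length = n + 1 →
        ((α ++ [i]).map f).prod = ((β ++ [i]).map f).prod := by
      intro i α β hα hβ hαβ hl
      have hα' : cs.IsReduced α := by simpa using hα.take α.length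
      have hβ' : cs.IsReduced β := by simpa using hβ.take β.length
      rw [wordProd_append, wordProd_append] at hαβ
      rw [List.map_append, List.map_append, List.prod_append, List.prod_append,
        ih hα' hβ' (mul_right_cancel hαβ) (by simpa using hl)]
    rcases List.eq_nil_or_concat' ω with rfl | ⟨α, i, rfl⟩
    · simp at hn
    rcases List.eq_nil_or_concat' ω' with rfl | ⟨β, j, rfl⟩
    · simp at hn'
    rcases eq_or_ne i j with rfl | hij
    · exact last i α β hω hω' h hn
    have desc : ∀ (i : B) (α : List B), cs.IsReduced (α ++ [i]) →
        cs.IsRightDescent (cs.wordProd (α ++ [i])) i := by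
      intro i α hα
      rw [IsRightDescent, hα.eq, wordProd_append, wordProd_singleton,
        simple_mul_simple_cancel_right, List.length_append, List.length_singleton]
      exact Nat.lt_succ_of_le (cs.length_wordProd_le α)
    obtain ⟨v, hv, hl⟩ := cs.exists_eq_mul_braidWord hij (hM i j) (desc i α hω)
      (h ▸ desc j β hω')
    obtain ⟨ρ, hρ, rfl⟩ := cs.exists_isReduced v
    obtain ⟨m, hm⟩ := Nat.exists_eq_succ_of_ne_zero (hM i j)
    have hm' : M j i = m + 1 := by rw [M.symmetric, hm]
    have e1 : braidWord M i j = alternatingWord j i m ++ [j] := by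
      rw [braidWord, hm, Nat.succ_eq_add_one, alternatingWord_succ, List.concat_eq_append]
    have e2 : braidWord M j i = alternatingWord i j m ++ [i] := by
      rw [braidWord, hm', alternatingWord_succ, List.concat_eq_append]
    have p1 : cs.wordProd (α ++ [i]) = cs.wordProd ((ρ ++ alternatingWord j i m) ++ [j]) := by
      rw [hv, List.append_assoc, ← e1, wordProd_append]
    have p2 : cs.wordProd (α ++ [i]) = cs.wordProd ((ρ ++ alternatingWord i j m) ++ [i]) := by
      rw [hv, List.append_assoc, ← e2, wordProd_append, cs.wordProd_braidWord_eq]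
    rw [hω.eq, hρ.eq, hm] at hl
    have r1 : cs.IsReduced ((ρ ++ alternatingWord j i m) ++ [j]) := by
      rw [IsReduced, ← p1, hω.eq, hl]; simp
    have r2 : cs.IsReduced ((ρ ++ alternatingWord i j m) ++ [i]) := by
      rw [IsReduced, ← p2, hω.eq, hl]; simp
    have q1 := last i _ _ hω r2 p2 hn
    have q2 := last j _ _ r1 hω' (p1.symm.trans h) (by rw [← r1.eq, ← p1, hω.eq, hn])
    rw [q1, ← q2, List.append_assoc, List.append_assoc, ← e1, ← e2, List.map_append,
      List.prod_append, hf j i, ← List.prod_append, ← List.map_append]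

end CoxeterSystem

/-! ### The weak order -/

namespace CoxeterSystem

variable {B W : Type*} [Group W] {M : CoxeterMatrix B} (cs : CoxeterSystem M W)

/-- The product `x * y` is length-additive. -/
def IsAdditive (x y : W) : Prop := cs.length (x * y) = cs.length x + cs.length y

/-- The weak order in which `x ≤ y` means that some reduced word of `x` is a prefix of a reduced
word of `y`. -/
def WeakLE (x y : W) : Prop := cs.length x + cs.length (x⁻¹ * y) = cs.length y

variable {cs}

theorem WeakLE.isAdditive {x y : W} (h : cs.WeakLE x y) : cs.IsAdditive x (x⁻¹ * y) := by
  rw [IsAdditive, mul_inv_cancel_left]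
  exact h.symm

theorem IsAdditive.weakLE {x y : W} (h : cs.IsAdditive x y) : cs.WeakLE x (x * y) := by
  rw [WeakLE, inv_mul_cancel_left]
  exact Eq.symm h

theorem IsAdditive.assoc_right {x y z : W} (h1 : cs.IsAdditive x y)
    (h2 : cs.IsAdditive (x * y) z) : cs.IsAdditive y z ∧ cs.IsAdditive x (y * z) := by
  have a := cs.length_mul_le y z
  have b := cs.length_mul_le x (y * z)
  simp only [IsAdditive, mul_assoc] at *
  omega

theorem IsAdditive.assoc_left {x y z : W} (h1 : cs.IsAdditive y z)
    (h2 : cs.IsAdditive x (y * z)) : cs.IsAdditive x y ∧ cs.IsAdditive (x * y) z := by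
  have a := cs.length_mul_le x y
  have b := cs.length_mul_le (x * y) z
  simp only [IsAdditive, mul_assoc] at *
  omega

theorem isAdditive_one_left (x : W) : cs.IsAdditive 1 x := by simp [IsAdditive]

theorem isAdditive_one_right (x : W) : cs.IsAdditive x 1 := by simp [IsAdditive]

theorem WeakLE.refl (x : W) : cs.WeakLE x x := by simp [WeakLE]

theorem one_weakLE (x : W) : cs.WeakLE 1 x := by simp [WeakLE]

theorem WeakLE.length_le {x y : W} (h : cs.WeakLE x y) : cs.length x ≤ cs.length y := by
  rw [WeakLE] at h
  omega

theorem WeakLE.trans {x y z : W} (h1 : cs.WeakLE x y) (h2 : cs.WeakLE y z) : cs.WeakLE x z := by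
  have a := cs.length_mul_le (x⁻¹ * y) (y⁻¹ * z)
  have b := cs.length_mul_le x (x⁻¹ * z)
  simp only [mul_assoc, mul_inv_cancel_left] at a b
  simp only [WeakLE] at *
  omega

theorem WeakLE.eq_of_length_le {x y : W} (h : cs.WeakLE x y) (hl : cs.length y ≤ cs.length x) :
    x = y := by
  rw [WeakLE] at h
  exact inv_mul_eq_one.1 (cs.length_eq_zero_iff.1 (by omega))

theorem WeakLE.antisymm {x y : W} (h1 : cs.WeakLE x y) (h2 : cs.WeakLE y x) : x = y :=
  h1.eq_of_length_le h2.length_le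

theorem eq_one_of_weakLE_one {x : W} (h : cs.WeakLE x 1) : x = 1 := h.antisymm (one_weakLE x)

theorem IsAdditive.mul_weakLE_mul_iff {x y z : W} (h1 : cs.IsAdditive x y)
    (h2 : cs.IsAdditive x z) : cs.WeakLE (x * y) (x * z) ↔ cs.WeakLE y z := by
  simp only [IsAdditive, WeakLE] at *
  rw [h1, h2, mul_inv_rev, mul_assoc, inv_mul_cancel_left]
  omega

theorem IsAdditive.of_weakLE {x y z : W} (h : cs.IsAdditive x z) (hy : cs.WeakLE y z) :
    cs.IsAdditive x y :=
  (hy.isAdditive.assoc_left (by rwa [mul_inv_cancel_left])).1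

theorem isAdditive_simple_right_iff {x : W} {i : B} :
    cs.IsAdditive x (cs.simple i) ↔ ¬ cs.IsRightDescent x i := by
  rw [not_isRightDescent_iff, IsAdditive, length_simple]

theorem simple_weakLE_iff {x : W} {i : B} :
    cs.WeakLE (cs.simple i) x ↔ cs.IsLeftDescent x i := by
  rw [isLeftDescent_iff, WeakLE, length_simple, inv_simple, add_comm]

theorem WeakLE.exists_simple {x y : W} (h : cs.WeakLE x y) (hne : x ≠ y) :
    ∃ i, cs.IsAdditive x (cs.simple i) ∧ cs.WeakLE (x * cs.simple i) y := by
  obtain ⟨i, hi⟩ := cs.exists_leftDescent_of_ne_one (w := x⁻¹ * y)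
    (fun h => hne (inv_mul_eq_one.1 h))
  have hi := simple_weakLE_iff.2 hi
  have ha := h.isAdditive.of_weakLE hi
  refine ⟨i, ha, ?_⟩
  have := (ha.mul_weakLE_mul_iff h.isAdditive).2 hi
  rwa [mul_inv_cancel_left] at this

theorem simple_weakLE_braidWord {i j : B} (hij : i ≠ j) (h0 : M i j ≠ 0) :
    cs.WeakLE (cs.simple j) (cs.wordProd (braidWord M i j)) := by
  rw [simple_weakLE_iff, ← isRightDescent_inv_iff, cs.inv_braidWord hij h0, IsRightDescent,
    cs.length_braidWord hij]
  obtain ⟨m, hm⟩ := Nat.exists_eq_succ_of_ne_zero h0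
  rw [braidWord, hm, Nat.succ_eq_add_one, alternatingWord_succ, wordProd_concat,
    simple_mul_simple_cancel_right]
  exact (cs.length_wordProd_le _).trans_lt (by rw [length_alternatingWord]; omega)

theorem braidWord_weakLE {i j : B} (hij : i ≠ j) (h0 : M i j ≠ 0) {u : W}
    (hi : cs.WeakLE (cs.simple i) u) (hj : cs.WeakLE (cs.simple j) u) :
    cs.WeakLE (cs.wordProd (braidWord M i j)) u := by
  rw [simple_weakLE_iff, ← isRightDescent_inv_iff] at hi hj
  obtain ⟨v, hv, hl⟩ := cs.exists_eq_mul_braidWord hij h0 hi hj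
  rw [inv_eq_iff_eq_inv, mul_inv_rev, cs.inv_braidWord hij h0] at hv
  rw [length_inv] at hl
  rw [WeakLE, hl, hv, inv_mul_cancel_left, length_inv, cs.length_braidWord hij, add_comm]

/-- A nonempty set that is closed under prefixes and under the dihedral joins of two covers of an
element has a greatest element in the weak order. This is the diamond lemma for going up along
covers inside the set. -/
theorem exists_greatest [Finite W] (C : W → Prop) (h1 : C 1)
    (hdown : ∀ x y, cs.WeakLE x y → C y → C x)
    (hstep : ∀ z i j, i ≠ j → cs.IsAdditive z (cs.simple i) → cs.IsAdditive z (cs.simple j) →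
      C (z * cs.simple i) → C (z * cs.simple j) → C (z * cs.wordProd (braidWord M i j))) :
    ∃ m, C m ∧ ∀ y, C y → cs.WeakLE y m := by
  obtain ⟨w, hw⟩ := Finite.exists_max cs.length
  have key : ∀ n z, cs.length w - cs.length z = n → C z →
      ∃ m, C m ∧ cs.WeakLE z m ∧ ∀ y, C y → cs.WeakLE z y → cs.WeakLE y m := by
    intro n
    induction n using Nat.strong_induction_on with
    | _ n ih =>
    intro z hz hC
    have ih' : ∀ z', cs.length z < cs.length z' → C z' →
        ∃ m, C m ∧ cs.WeakLE z' m ∧ ∀ y, C y → cs.WeakLE z' y → cs.WeakLE y m := by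
      intro z' hl hC'
      have := hw z'
      exact ih _ (by omega) z' rfl hC'
    have up : ∀ i, cs.IsAdditive z (cs.simple i) → cs.length z < cs.length (z * cs.simple i) := by
      intro i hi
      rw [IsAdditive, length_simple] at hi
      omega
    by_cases hex : ∃ i, cs.IsAdditive z (cs.simple i) ∧ C (z * cs.simple i)
    · obtain ⟨i, hi, hCi⟩ := hex
      obtain ⟨m, hCm, hm, hmax⟩ := ih' _ (up i hi) hCi
      refine ⟨m, hCm, hi.weakLE.trans hm, fun y hy hzy => ?_⟩
      by_cases hne : z = y
      · exact hne ▸ hi.weakLE.trans hm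
      obtain ⟨j, hj, hjy⟩ := hzy.exists_simple hne
      by_cases hij : i = j
      · exact hmax y hy (hij ▸ hjy)
      have hCj := hdown _ _ hjy hy
      have h0 := coxeterMatrix_ne_zero cs i j
      have hCb := hstep z i j hij hi hj hCi hCj
      have hb : cs.IsAdditive z (cs.wordProd (braidWord M i j)) := by
        rw [IsAdditive, cs.length_mul_braidWord hij h0 (isAdditive_simple_right_iff.1 hi)
          (isAdditive_simple_right_iff.1 hj), cs.length_braidWord hij]
      have hjb := (hj.mul_weakLE_mul_iff hb).2 (simple_weakLE_braidWord hij h0)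
      have hib : cs.WeakLE (z * cs.simple i) (z * cs.wordProd (braidWord M i j)) := by
        rw [hi.mul_weakLE_mul_iff hb, cs.wordProd_braidWord_eq]
        exact simple_weakLE_braidWord (Ne.symm hij) (by rwa [M.symmetric])
      obtain ⟨m', hCm', hm', hmax'⟩ := ih' _ (up j hj) hCj
      obtain ⟨m'', hCm'', hm'', hmax''⟩ := ih' _ ((up j hj).trans_le hjb.length_le) hCb
      -- All three maxima lie above the dihedral join, so they agree.
      have e : m = m'' := (hmax'' m hCm (hmax _ hCb hib)).antisymm
        (hmax m'' hCm'' (hib.trans hm''))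
      have e' : m' = m'' := (hmax'' m' hCm' (hmax' _ hCb hjb)).antisymm
        (hmax' m'' hCm'' (hjb.trans hm''))
      rw [e, ← e']
      exact hmax' y hy hjy
    · refine ⟨z, hC, WeakLE.refl z, fun y hy hzy => ?_⟩
      by_cases hne : z = y
      · exact hne ▸ WeakLE.refl z
      obtain ⟨j, hj, hjy⟩ := hzy.exists_simple hne
      exact (hex ⟨j, hj, hdown _ _ hjy hy⟩).elim
  obtain ⟨m, hCm, -, hm⟩ := key _ 1 rfl h1
  exact ⟨m, hCm, fun y hy => hm y hy (one_weakLE y)⟩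

theorem braidWord_weakLE_of_mul [Finite W] {z y : W} {i j : B} (hij : i ≠ j)
    (hi : cs.IsAdditive z (cs.simple i)) (hj : cs.IsAdditive z (cs.simple j))
    (hiy : cs.WeakLE (z * cs.simple i) y) (hjy : cs.WeakLE (z * cs.simple j) y) :
    cs.WeakLE (z * cs.wordProd (braidWord M i j)) y := by
  have h0 := coxeterMatrix_ne_zero cs i j
  have hzy : cs.IsAdditive z (z⁻¹ * y) := (hi.weakLE.trans hiy).isAdditive
  have key := braidWord_weakLE (cs := cs) (u := z⁻¹ * y) hij h0
    ((hi.mul_weakLE_mul_iff hzy).1 (by rwa [mul_inv_cancel_left]))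
    ((hj.mul_weakLE_mul_iff hzy).1 (by rwa [mul_inv_cancel_left]))
  have := ((hzy.of_weakLE key).mul_weakLE_mul_iff hzy).2 key
  rwa [mul_inv_cancel_left] at this

theorem exists_meet [Finite W] (a b : W) : ∃ m, cs.WeakLE m a ∧ cs.WeakLE m b ∧
    ∀ y, cs.WeakLE y a → cs.WeakLE y b → cs.WeakLE y m := by
  obtain ⟨m, ⟨ha, hb⟩, hm⟩ := exists_greatest (cs := cs)
    (fun z => cs.WeakLE z a ∧ cs.WeakLE z b) ⟨one_weakLE a, one_weakLE b⟩
    (fun x y hxy hy => ⟨hxy.trans hy.1, hxy.trans hy.2⟩)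
    (fun z i j hij hi hj hCi hCj => ⟨braidWord_weakLE_of_mul hij hi hj hCi.1 hCj.1,
      braidWord_weakLE_of_mul hij hi hj hCi.2 hCj.2⟩)
  exact ⟨m, ha, hb, fun y hya hyb => hm y ⟨hya, hyb⟩⟩

theorem exists_transfer [Finite W] (x y : W) : ∃ t, (cs.WeakLE t y ∧ cs.IsAdditive x t) ∧
    ∀ z, cs.WeakLE z y ∧ cs.IsAdditive x z → cs.WeakLE z t := by
  refine exists_greatest (fun z => cs.WeakLE z y ∧ cs.IsAdditive x z)
    ⟨one_weakLE y, isAdditive_one_right x⟩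
    (fun z z' hz h => ⟨hz.trans h.1, h.2.of_weakLE hz⟩) ?_
  rintro z i j hij hi hj ⟨hiy, hxi⟩ ⟨hjy, hxj⟩
  refine ⟨braidWord_weakLE_of_mul hij hi hj hiy hjy, ?_⟩
  have h0 := coxeterMatrix_ne_zero cs i j
  obtain ⟨hxz, hxzi⟩ := hi.assoc_left hxi
  obtain ⟨-, hxzj⟩ := hj.assoc_left hxj
  have hb : cs.IsAdditive (x * z) (cs.wordProd (braidWord M i j)) := by
    rw [IsAdditive, cs.length_mul_braidWord hij h0 (isAdditive_simple_right_iff.1 hxzi)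
      (isAdditive_simple_right_iff.1 hxzj), cs.length_braidWord hij]
  exact (hxz.assoc_right hb).2

variable (cs)

/-- The greatest prefix `t` of `y` such that `x * t` is length-additive. -/
noncomputable def transfer [Finite W] (x y : W) : W := (exists_transfer (cs := cs) x y).choose

/-- The first factor of the greedy normal form of the product of `x` and `y`. -/
noncomputable def head [Finite W] (x y : W) : W := x * cs.transfer x y

/-- What remains of the product of `x` and `y` after `head x y`. -/
noncomputable def tail [Finite W] (x y : W) : W := (cs.transfer x y)⁻¹ * y

section

variable [Finite W]

theorem transfer_weakLE (x y : W) : cs.WeakLE (cs.transfer x y) y :=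
  (exists_transfer (cs := cs) x y).choose_spec.1.1

theorem isAdditive_transfer (x y : W) : cs.IsAdditive x (cs.transfer x y) :=
  (exists_transfer (cs := cs) x y).choose_spec.1.2

theorem weakLE_transfer {x y z : W} (h : cs.WeakLE z y) (h' : cs.IsAdditive x z) :
    cs.WeakLE z (cs.transfer x y) :=
  (exists_transfer (cs := cs) x y).choose_spec.2 z ⟨h, h'⟩

theorem transfer_mul_tail (x y : W) : cs.transfer x y * cs.tail x y = y := by
  rw [tail, mul_inv_cancel_left]

theorem isAdditive_transfer_tail (x y : W) :
    cs.IsAdditive (cs.transfer x y) (cs.tail x y) :=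
  (cs.transfer_weakLE x y).isAdditive

theorem weakLE_head (x y : W) : cs.WeakLE x (cs.head x y) := (cs.isAdditive_transfer x y).weakLE

/-- After `y` has absorbed what it can from `z`, the factor `x` absorbs `y` and precisely what
`x * y` can absorb from `z`. The associativity of `head` and `tail` follows. -/
theorem transfer_mul {x y : W} (h : cs.IsAdditive x y) (z : W) :
    cs.transfer x (cs.head y z) = y * cs.transfer (x * y) z := by
  have h1 := cs.isAdditive_transfer (x * y) z
  obtain ⟨h2, h3⟩ := h.assoc_right h1
  have h4 := cs.isAdditive_transfer y z
  refine WeakLE.antisymm (cs := cs) ?_ (cs.weakLE_transfer ?_ h3)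
  · -- The left side is `y * t'` with `t'` a prefix of `z`, by comparison with `y` and `head y z`.
    set r := cs.transfer x (cs.head y z)
    have hyr : cs.WeakLE y r := cs.weakLE_transfer (cs.weakLE_head y z) h
    have hr : y * (y⁻¹ * r) = r := mul_inv_cancel_left y r
    have ha : cs.IsAdditive y (y⁻¹ * r) := hyr.isAdditive
    have hz : cs.WeakLE (y⁻¹ * r) z := by
      refine WeakLE.trans ((ha.mul_weakLE_mul_iff h4).1 ?_) (cs.transfer_weakLE y z)
      rw [hr]
      exact cs.transfer_weakLE x (cs.head y z)
    have hx : cs.IsAdditive (x * y) (y⁻¹ * r) := by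
      refine (ha.assoc_left ?_).2
      rw [hr]
      exact cs.isAdditive_transfer x (cs.head y z)
    have := (ha.mul_weakLE_mul_iff h2).2 (cs.weakLE_transfer hz hx)
    rwa [hr] at this
  · exact (h2.mul_weakLE_mul_iff h4).2 (cs.weakLE_transfer (cs.transfer_weakLE _ _) h2)

theorem head_mul {x y : W} (h : cs.IsAdditive x y) (z : W) :
    cs.head (x * y) z = cs.head x (cs.head y z) := by
  rw [head, head, cs.transfer_mul h, mul_assoc]

theorem tail_mul {x y : W} (h : cs.IsAdditive x y) (z : W) :
    cs.tail (x * y) z = cs.tail x (cs.head y z) * cs.tail y z := by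
  rw [tail, tail, tail, cs.transfer_mul h, head]
  group

theorem isAdditive_tail {x y : W} (h : cs.IsAdditive x y) (z : W) :
    cs.IsAdditive (cs.tail x (cs.head y z)) (cs.tail y z) := by
  have h1 : cs.tail x (cs.head y z) = (cs.transfer (x * y) z)⁻¹ * cs.transfer y z := by
    rw [tail, cs.transfer_mul h, head]
    group
  have h2 : cs.WeakLE (cs.transfer (x * y) z) (cs.transfer y z) :=
    cs.weakLE_transfer (cs.transfer_weakLE _ _)
      (h.assoc_right (cs.isAdditive_transfer (x * y) z)).1
  rw [h1]
  refine (h2.isAdditive.assoc_right ?_).1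
  rw [mul_inv_cancel_left]
  exact cs.isAdditive_transfer_tail y z

theorem head_mono {x y z : W} (h : cs.WeakLE y z) : cs.WeakLE (cs.head x y) (cs.head x z) :=
  ((cs.isAdditive_transfer x y).mul_weakLE_mul_iff (cs.isAdditive_transfer x z)).2
    (cs.weakLE_transfer ((cs.transfer_weakLE x y).trans h) (cs.isAdditive_transfer x y))

/-- The elements `r` with `d ≤ head x r` are closed under meets. -/
theorem weakLE_head_of_meet {x d y z m : W}
    (hm : ∀ r, cs.WeakLE r y → cs.WeakLE r z → cs.WeakLE r m)
    (hy : cs.WeakLE d (cs.head x y)) (hz : cs.WeakLE d (cs.head x z)) :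
    cs.WeakLE d (cs.head x m) := by
  obtain ⟨e, hey, hez, he⟩ := exists_meet (cs := cs) (cs.head x y) (cs.head x z)
  have hxe := he x (cs.weakLE_head x y) (cs.weakLE_head x z)
  have hr : x * (x⁻¹ * e) = e := mul_inv_cancel_left x e
  have below : ∀ y, cs.WeakLE e (cs.head x y) → cs.WeakLE (x⁻¹ * e) y := by
    intro y hey
    refine WeakLE.trans ((hxe.isAdditive.mul_weakLE_mul_iff (cs.isAdditive_transfer x y)).1 ?_)
      (cs.transfer_weakLE x y)
    rwa [hr]
  have h1 := cs.weakLE_transfer (hm _ (below y hey) (below z hez)) hxe.isAdditive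
  have h2 := (hxe.isAdditive.mul_weakLE_mul_iff (cs.isAdditive_transfer x m)).2 h1
  rw [hr] at h2
  exact (he d hy hz).trans h2

theorem transfer_one_left (y : W) : cs.transfer 1 y = y :=
  (cs.transfer_weakLE 1 y).antisymm
    (cs.weakLE_transfer (WeakLE.refl y) (isAdditive_one_left y))

theorem transfer_one_right (x : W) : cs.transfer x 1 = 1 :=
  eq_one_of_weakLE_one (cs.transfer_weakLE x 1)

theorem head_one_left (y : W) : cs.head 1 y = y := by rw [head, transfer_one_left, one_mul]

theorem tail_one_left (y : W) : cs.tail 1 y = 1 := by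
  rw [tail, transfer_one_left, inv_mul_cancel]

theorem head_one_right (x : W) : cs.head x 1 = x := by rw [head, transfer_one_right, mul_one]

theorem transfer_eq_one_of_head {x y : W} (h : cs.head x y = x) : cs.transfer x y = 1 := by
  rwa [head, mul_eq_left] at h

end

/-- An element of maximal length. -/
def IsLongest (w₀ : W) : Prop := ∀ w, cs.length w ≤ cs.length w₀

variable {cs}

namespace IsLongest

variable {w₀ : W}

theorem eq_one_of_isAdditive (h : cs.IsLongest w₀) {w : W} (hw : cs.IsAdditive w₀ w) : w = 1 := by
  have := h (w₀ * w)
  rw [hw] at this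
  exact cs.length_eq_zero_iff.1 (by omega)

variable [Finite W]

theorem weakLE (h : cs.IsLongest w₀) (w : W) : cs.WeakLE w w₀ := by
  obtain ⟨m, -, hm⟩ := exists_greatest (cs := cs) (fun _ => True) trivial
    (fun _ _ _ _ => trivial) (fun _ _ _ _ _ _ _ _ => trivial)
  rw [(hm w₀ trivial).eq_of_length_le (h m)]
  exact hm w trivial

theorem eq_of_length_le (h : cs.IsLongest w₀) {w : W} (hw : cs.length w₀ ≤ cs.length w) :
    w = w₀ := (h.weakLE w).eq_of_length_le hw

theorem inv_eq (h : cs.IsLongest w₀) : w₀⁻¹ = w₀ := h.eq_of_length_le (cs.length_inv w₀).ge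

theorem mul_self (h : cs.IsLongest w₀) : w₀ * w₀ = 1 := by
  nth_rw 1 [← h.inv_eq]
  exact inv_mul_cancel w₀

theorem isAdditive_inv_mul (h : cs.IsLongest w₀) (w : W) : cs.IsAdditive w (w⁻¹ * w₀) :=
  (h.weakLE w).isAdditive

theorem length_mul_right (h : cs.IsLongest w₀) (w : W) :
    cs.length w + cs.length (w * w₀) = cs.length w₀ := by
  have := h.weakLE w⁻¹
  rwa [WeakLE, length_inv, inv_inv] at this

theorem length_mul_left (h : cs.IsLongest w₀) (w : W) :
    cs.length w + cs.length (w₀ * w) = cs.length w₀ := by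
  have := h.length_mul_right w⁻¹
  rwa [length_inv, ← cs.length_inv (w⁻¹ * w₀), mul_inv_rev, inv_inv, h.inv_eq] at this

theorem isAdditive_mul_right (h : cs.IsLongest w₀) (w : W) : cs.IsAdditive (w₀ * w) w⁻¹ := by
  rw [IsAdditive, mul_inv_cancel_right, length_inv, add_comm]
  exact (h.length_mul_left w).symm

theorem length_conj (h : cs.IsLongest w₀) (w : W) : cs.length (w₀ * w * w₀) = cs.length w := by
  have h1 := h.length_mul_right (w₀ * w)
  have h2 := h.length_mul_left w
  omega

theorem tail_left (h : cs.IsLongest w₀) (w : W) : cs.tail w₀ w = w := by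
  rw [tail, h.eq_one_of_isAdditive (cs.isAdditive_transfer w₀ w), inv_one, one_mul]

end IsLongest

end CoxeterSystem

/-! ### Left multiplication on normal sequences -/

namespace CoxeterSystem

variable {B W : Type*} [Group W] {M : CoxeterMatrix B} (cs : CoxeterSystem M W) [Finite W]

/-- When `x` is multiplied from the left into the product `a 0 * a 1 * ⋯`, the factor that is
carried to position `n`. -/
noncomputable def carry (x : W) (a : ℕ → W) : ℕ → W
  | 0 => x
  | n + 1 => cs.tail (carry x a n) (a n)

/-- Left multiplication by `x` on sequences, thought of as formal products `a 0 * a 1 * ⋯`. -/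
noncomputable def leftMul (x : W) (a : ℕ → W) : ℕ → W := fun n => cs.head (cs.carry x a n) (a n)

theorem carry_mul {x y : W} (h : cs.IsAdditive x y) (a : ℕ → W) (n : ℕ) :
    cs.IsAdditive (cs.carry x (cs.leftMul y a) n) (cs.carry y a n) ∧
      cs.carry (x * y) a n = cs.carry x (cs.leftMul y a) n * cs.carry y a n := by
  induction n with
  | zero => exact ⟨h, rfl⟩
  | succ n ih =>
    refine ⟨cs.isAdditive_tail ih.1 (a n), ?_⟩
    rw [carry, ih.2, cs.tail_mul ih.1]
    rfl

theorem leftMul_mul {x y : W} (h : cs.IsAdditive x y) (a : ℕ → W) :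
    cs.leftMul (x * y) a = cs.leftMul x (cs.leftMul y a) := by
  funext n
  obtain ⟨h1, h2⟩ := cs.carry_mul h a n
  rw [leftMul, h2, cs.head_mul h1]
  rfl

/-- A sequence of group elements in which no factor can absorb a part of the next one. -/
def IsNormalSeq (a : ℕ → W) : Prop := ∀ n, cs.head (a n) (a (n + 1)) = a n

variable {cs}

/-- Left multiplication preserves normal sequences: let `q` be carried to position `n`. Moving a
prefix of `a n` over to `q` does not change the first factor of `q * a n * a (n + 1)`, and this
factor is `head q (a n)` because `a` is normal. -/
theorem IsNormalSeq.leftMul {a : ℕ → W} (ha : cs.IsNormalSeq a) (x : W) :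
    cs.IsNormalSeq (cs.leftMul x a) := by
  intro n
  set q := cs.carry x a n with hq
  have h1 : cs.leftMul x a (n + 1) = cs.head (cs.tail q (a n)) (a (n + 1)) := rfl
  have h2 : cs.leftMul x a n = q * cs.transfer q (a n) := rfl
  rw [h1, h2, cs.head_mul (cs.isAdditive_transfer q (a n)),
    ← cs.head_mul (cs.isAdditive_transfer_tail q (a n)), cs.transfer_mul_tail, ha n]
  rfl

theorem isNormalSeq_one : cs.IsNormalSeq fun _ => 1 := fun _ => cs.head_one_left 1

theorem IsNormalSeq.tail_eq {a : ℕ → W} (ha : cs.IsNormalSeq a) (n : ℕ) :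
    cs.tail (a n) (a (n + 1)) = a (n + 1) := by
  rw [tail, cs.transfer_eq_one_of_head (ha n), inv_one, one_mul]

theorem IsNormalSeq.carry_shift {a : ℕ → W} (ha : cs.IsNormalSeq a) (n : ℕ) :
    cs.carry (a 0) (fun n => a (n + 1)) n = a n := by
  induction n with
  | zero => rfl
  | succ n ih => rw [carry, ih, ha.tail_eq]

theorem IsNormalSeq.leftMul_shift {a : ℕ → W} (ha : cs.IsNormalSeq a) :
    cs.leftMul (a 0) (fun n => a (n + 1)) = a := by
  funext n
  rw [CoxeterSystem.leftMul, ha.carry_shift, ha n]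

variable (cs)

theorem leftMul_zero (x : W) (a : ℕ → W) : cs.leftMul x a 0 = cs.head x (a 0) := rfl

theorem carry_succ (x : W) (a : ℕ → W) (n : ℕ) :
    cs.carry x a (n + 1) = cs.carry (cs.tail x (a 0)) (fun n => a (n + 1)) n := by
  induction n with
  | zero => rfl
  | succ n ih => rw [carry, ih, carry]

theorem leftMul_succ (x : W) (a : ℕ → W) (n : ℕ) :
    cs.leftMul x a (n + 1) = cs.leftMul (cs.tail x (a 0)) (fun n => a (n + 1)) n := by
  rw [leftMul, carry_succ]
  rfl

theorem leftMul_one_left (a : ℕ → W) : cs.leftMul 1 a = a := by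
  have h : ∀ n, cs.carry 1 a n = 1 := by
    intro n
    induction n with
    | zero => rfl
    | succ n ih => rw [carry, ih, tail_one_left]
  funext n
  rw [leftMul, h, head_one_left]

theorem leftMul_eq_one {x : W} {a : ℕ → W} {n : ℕ} (h : cs.leftMul x a n = 1) : a n = 1 := by
  have h1 : cs.carry x a n = 1 := by
    refine eq_one_of_weakLE_one (cs := cs) ?_
    rw [← h]
    exact cs.weakLE_head _ _
  rwa [leftMul, h1, head_one_left] at h

variable {cs}

theorem IsLongest.leftMul_succ {w₀ : W} (h : cs.IsLongest w₀) {a : ℕ → W}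
    (ha : cs.IsNormalSeq a) (n : ℕ) : cs.leftMul w₀ a (n + 1) = a n := by
  rw [CoxeterSystem.leftMul_succ, h.tail_left, ha.leftMul_shift]

variable (cs)

/-- Left multiplication as a self-map of the set of normal sequences. -/
noncomputable def normalMul (x : W) : Function.End {a : ℕ → W // cs.IsNormalSeq a} :=
  fun a => ⟨cs.leftMul x a.1, a.2.leftMul x⟩

theorem normalMul_mul {x y : W} (h : cs.IsAdditive x y) :
    cs.normalMul (x * y) = cs.normalMul x * cs.normalMul y :=
  funext fun a => Subtype.ext (cs.leftMul_mul h a.1)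

theorem normalMul_one : cs.normalMul 1 = 1 := funext fun a => Subtype.ext (cs.leftMul_one_left a.1)

theorem normalMul_wordProd {ω : List B} (hω : cs.IsReduced ω) :
    cs.normalMul (cs.wordProd ω) = (ω.map fun i => cs.normalMul (cs.simple i)).prod := by
  induction ω with
  | nil => simp [normalMul_one]
  | cons i ω ih =>
    have h1 : cs.IsReduced ω := hω.drop 1
    have h2 : cs.IsAdditive (cs.simple i) (cs.wordProd ω) := by
      rw [IsAdditive, ← wordProd_cons, hω.eq, h1.eq, length_simple, List.length_cons, add_comm]
    rw [wordProd_cons, normalMul_mul cs h2, ih h1, List.map_cons, List.prod_cons]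

variable {cs}

theorem IsLongest.normalMul_injective {w₀ : W} (h : cs.IsLongest w₀) :
    Function.Injective (cs.normalMul w₀) := by
  intro a b hab
  refine Subtype.ext (funext fun n => ?_)
  rw [← h.leftMul_succ a.2 n, ← h.leftMul_succ b.2 n]
  exact congrFun (congrArg Subtype.val hab) (n + 1)

/-- The longest element intertwines `x` and `w₀ * x * w₀`, because of the additive factorizations
`w₀ = (w₀ * x * w₀) * (w₀ * x⁻¹)` and `w₀ = (w₀ * x⁻¹) * x`. -/
theorem IsLongest.normalMul_comm {w₀ : W} (h : cs.IsLongest w₀) (x : W) :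
    cs.normalMul w₀ * cs.normalMul x = cs.normalMul (w₀ * x * w₀) * cs.normalMul w₀ := by
  have e1 : w₀ = (w₀ * x * w₀) * (w₀ * x⁻¹) := by
    rw [mul_assoc, ← mul_assoc w₀ w₀, h.mul_self, one_mul, mul_inv_cancel_right]
  have e2 : w₀ = w₀ * x⁻¹ * x := by rw [inv_mul_cancel_right]
  have a2 : cs.IsAdditive (w₀ * x⁻¹) x := by simpa using h.isAdditive_mul_right x⁻¹
  have a1 : cs.IsAdditive (w₀ * x * w₀) (w₀ * x⁻¹) := by
    have := h.length_mul_left x⁻¹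
    rw [length_inv] at this
    rw [IsAdditive, ← e1, h.length_conj, this]
  have k1 := cs.normalMul_mul a1
  have k2 := cs.normalMul_mul a2
  rw [← e1] at k1
  rw [← e2] at k2
  nth_rw 1 [k1]
  rw [mul_assoc, ← k2]

end CoxeterSystem

/-! ### Localization at a central element -/

/-- The submonoid of powers of a central element satisfies the Ore condition. -/
@[reducible]
noncomputable def oreSetOfCentral {E : Type*} [Monoid E] (c : E) (hc : ∀ x, Commute c x) :
    OreLocalization.OreSet (Submonoid.powers c) where
  ore_right_cancel r₁ r₂ s h := by
    refine ⟨s, ?_⟩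
    obtain ⟨n, hn⟩ := s.2
    rw [← hn, ((hc r₁).pow_left n).eq, ((hc r₂).pow_left n).eq]
    simpa only [← hn] using h
  oreNum r _ := r
  oreDenom _ s := s
  ore_eq r s := by
    obtain ⟨n, hn⟩ := s.2
    rw [← hn, ((hc r).pow_left n).eq]

/-- A monoid with a central cancellable element embeds into one in which all divisors of that
element are invertible. -/
theorem exists_embedding_of_central.{u} {E : Type u} [Monoid E] (c : E) (hc : ∀ x, Commute c x)
    (hinj : ∀ x y, c * x = c * y → x = y) :
    ∃ (F : Type u) (_ : Monoid F) (φ : E →* F), Function.Injective φ ∧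
      ∀ x y z, x * y = c → z * x = c → IsUnit (φ x) := by
  let _ := oreSetOfCentral c hc
  refine ⟨OreLocalization (Submonoid.powers c) E, inferInstance, OreLocalization.numeratorHom,
    ?_, ?_⟩
  · intro x y h
    rw [OreLocalization.numeratorHom_apply, OreLocalization.numeratorHom_apply,
      OreLocalization.oreDiv_eq_iff] at h
    obtain ⟨u, v, h1, h2⟩ := h
    obtain ⟨n, hn⟩ := u.2
    have h3 : (u : E) = v := by simpa using h2
    have h1 : (u : E) * y = v * x := h1
    rw [← h3, ← hn] at h1
    have pow_inj : ∀ n : ℕ, ∀ x y : E, c ^ n * x = c ^ n * y → x = y := by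
      intro n
      induction n with
      | zero => intro x y h; simpa using h
      | succ n ih =>
        intro x y h
        rw [pow_succ', mul_assoc, mul_assoc] at h
        exact ih x y (hinj _ _ h)
    exact (pow_inj n _ _ h1).symm
  · intro x y z hxy hzx
    let φ : E →* OreLocalization (Submonoid.powers c) E := OreLocalization.numeratorHom
    obtain ⟨u, hu⟩ : IsUnit (φ c) :=
      OreLocalization.numerator_isUnit (⟨c, Submonoid.mem_powers c⟩ : Submonoid.powers c)
    have h1 : φ x * φ y = u := by rw [← map_mul, hxy, hu]
    have h2 : φ z * φ x = u := by rw [← map_mul, hzx, hu]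
    have h3 : φ x * (φ y * (↑u⁻¹ : OreLocalization (Submonoid.powers c) E)) = 1 := by
      rw [← mul_assoc, h1, Units.mul_inv]
    have h4 : (↑u⁻¹ : OreLocalization (Submonoid.powers c) E) * φ z * φ x = 1 := by
      rw [mul_assoc, h2, Units.inv_mul]
    exact isUnit_iff_exists_and_exists.2 ⟨⟨_, h3⟩, ⟨_, h4⟩⟩

/-! ### Atoms and the action of the Artin group -/

namespace CoxeterMatrix

variable {B : Type*} (M : CoxeterMatrix B)

theorem artinGen_braid (i j : B) :
    ((CoxeterSystem.braidWord M i j).map M.artinGen).prod =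
      ((CoxeterSystem.braidWord M j i).map M.artinGen).prod := by
  have key : ∀ ω : List B, PresentedGroup.mk M.artinRelations (ω.map FreeGroup.of).prod =
      (ω.map M.artinGen).prod := by
    intro ω
    rw [map_list_prod, List.map_map]
    rfl
  have h := PresentedGroup.one_of_mem (rels := M.artinRelations) ⟨i, j, rfl⟩
  rw [map_mul, map_inv, key, key] at h
  exact mul_inv_eq_one.1 h

theorem positiveWord_nil : M.positiveWord [] = 1 := rfl

theorem positiveWord_cons (i : B) (ω : List B) :
    M.positiveWord (i :: ω) = M.artinGen i * M.positiveWord ω := by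
  rw [positiveWord, List.map_cons, List.prod_cons, positiveWord]

theorem positiveWord_append (ω ω' : List B) :
    M.positiveWord (ω ++ ω') = M.positiveWord ω * M.positiveWord ω' := by
  rw [positiveWord, List.map_append, List.prod_append, positiveWord, positiveWord]

theorem exists_positiveWord {x : M.ArtinGroup} (hx : x ∈ M.artinMonoid) :
    ∃ ω, M.positiveWord ω = x := by
  induction hx using Submonoid.closure_induction with
  | mem x hx =>
    obtain ⟨i, rfl⟩ := hx
    exact ⟨[i], by simp [positiveWord]⟩
  | one => exact ⟨[], rfl⟩
  | mul x y _ _ hx hy =>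
    obtain ⟨ω, rfl⟩ := hx
    obtain ⟨ω', rfl⟩ := hy
    exact ⟨ω ++ ω', M.positiveWord_append ω ω'⟩

section Lift

variable {M}

/-- The universal property of the Artin group, in terms of positive words. -/
theorem exists_artinLift {G : Type*} [Group G] (f : B → G)
    (hf : ∀ i j, ((CoxeterSystem.braidWord M i j).map f).prod =
      ((CoxeterSystem.braidWord M j i).map f).prod) :
    ∃ φ : M.ArtinGroup →* G, ∀ ω, φ (M.positiveWord ω) = (ω.map f).prod := by
  have key : ∀ ω : List B, FreeGroup.lift f (ω.map FreeGroup.of).prod = (ω.map f).prod := by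
    intro ω
    rw [map_list_prod, List.map_map]
    congr 1
    exact List.map_congr_left fun i _ => FreeGroup.lift_apply_of
  have hrel : ∀ r ∈ M.artinRelations, FreeGroup.lift f r = 1 := by
    rintro r ⟨i, j, rfl⟩
    rw [map_mul, map_inv, key, key, hf, mul_inv_cancel]
  let φ : M.ArtinGroup →* G := PresentedGroup.toGroup hrel
  have hφ : ∀ i, φ (M.artinGen i) = f i := fun i => PresentedGroup.toGroup.of hrel
  refine ⟨φ, fun ω => ?_⟩
  induction ω with
  | nil => exact map_one φ
  | cons i ω ih => rw [positiveWord_cons, map_mul, hφ, ih, List.map_cons, List.prod_cons]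

/-- A family in a monoid satisfying the braid relations, all of whose members divide a central
cancellable element, has equal products along positive words that agree in the Artin *group*. -/
theorem map_prod_eq_of_positiveWord_eq {E : Type*} [Monoid E] (c : E)
    (hc : ∀ x, Commute c x) (hinj : ∀ x y, c * x = c * y → x = y) (f : B → E)
    (hf : ∀ i j, ((CoxeterSystem.braidWord M i j).map f).prod =
      ((CoxeterSystem.braidWord M j i).map f).prod)
    (hdiv : ∀ i, ∃ y z, f i * y = c ∧ z * f i = c) {ω ω' : List B}
    (h : M.positiveWord ω = M.positiveWord ω') : (ω.map f).prod = (ω'.map f).prod := by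
  obtain ⟨F, _, φ, hφ, hunit⟩ := exists_embedding_of_central c hc hinj
  choose y z hy hz using hdiv
  choose u hu using fun i => hunit _ _ _ (hy i) (hz i)
  have key : ∀ ω : List B, (((ω.map u).prod : Fˣ) : F) = φ (ω.map f).prod := by
    intro ω
    rw [← Units.coeHom_apply, map_list_prod, map_list_prod, List.map_map, List.map_map]
    congr 1
    exact List.map_congr_left fun i _ => hu i
  obtain ⟨ψ, hψ⟩ := exists_artinLift (M := M) u (fun i j => Units.ext (by rw [key, key, hf]))
  refine hφ ?_
  rw [← key, ← key, ← hψ, ← hψ, h]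

end Lift

theorem exists_degree : ∃ φ : M.ArtinGroup →* Multiplicative ℤ,
    ∀ ω, φ (M.positiveWord ω) = Multiplicative.ofAdd (ω.length : ℤ) := by
  obtain ⟨φ, hφ⟩ := exists_artinLift (M := M) (fun _ => Multiplicative.ofAdd (1 : ℤ))
    (fun i j => by
      simp only [List.map_const', List.prod_replicate, CoxeterSystem.length_alternatingWord,
        M.symmetric i j])
  refine ⟨φ, fun ω => ?_⟩
  rw [hφ, List.map_const', List.prod_replicate, ← ofAdd_nsmul]
  simp

theorem length_eq_of_positiveWord_eq {ω ω' : List B}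
    (h : M.positiveWord ω = M.positiveWord ω') : ω.length = ω'.length := by
  obtain ⟨φ, hφ⟩ := M.exists_degree
  have h1 := congrArg φ h
  rw [hφ, hφ] at h1
  exact_mod_cast Multiplicative.ofAdd.injective h1

theorem wordLength_positiveWord (ω : List B) : M.wordLength (M.positiveWord ω) = ω.length := by
  have h : {n | ∃ ω' : List B, ω'.length = n ∧ M.positiveWord ω' = M.positiveWord ω} =
      {ω.length} := by
    ext n
    constructor
    · rintro ⟨ω', rfl, h⟩
      exact M.length_eq_of_positiveWord_eq h
    · rintro rfl
      exact ⟨ω, rfl, rfl⟩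
  rw [wordLength, h, csInf_singleton]

theorem wordLength_mul {x y : M.ArtinGroup} (hx : x ∈ M.artinMonoid) (hy : y ∈ M.artinMonoid) :
    M.wordLength (x * y) = M.wordLength x + M.wordLength y := by
  obtain ⟨ω, rfl⟩ := M.exists_positiveWord hx
  obtain ⟨ω', rfl⟩ := M.exists_positiveWord hy
  simp only [← positiveWord_append, wordLength_positiveWord, List.length_append]

theorem wordLength_one : M.wordLength 1 = 0 := M.wordLength_positiveWord []

theorem eq_one_of_wordLength_eq_zero {x : M.ArtinGroup} (hx : x ∈ M.artinMonoid)
    (h : M.wordLength x = 0) : x = 1 := by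
  obtain ⟨ω, rfl⟩ := M.exists_positiveWord hx
  rw [wordLength_positiveWord, List.length_eq_zero_iff] at h
  rw [h, positiveWord_nil]

/-- The atom with image `w` in the Coxeter group. -/
noncomputable def atom (w : M.Group) : M.ArtinGroup :=
  M.positiveWord (M.toCoxeterSystem.exists_isReduced w).choose

theorem atom_mem (w : M.Group) : M.atom w ∈ M.artinMonoid := M.positiveWord_mem _

theorem artinProj_atom (w : M.Group) : M.artinProj (M.atom w) = w := by
  rw [atom, artinProj_positiveWord]
  exact (M.toCoxeterSystem.exists_isReduced w).choose_spec.2.symm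

theorem atom_injective : Function.Injective M.atom :=
  Function.LeftInverse.injective M.artinProj_atom

theorem wordLength_atom (w : M.Group) :
    M.wordLength (M.atom w) = M.toCoxeterSystem.length w := by
  obtain ⟨h1, h2⟩ := (M.toCoxeterSystem.exists_isReduced w).choose_spec
  rw [atom, wordLength_positiveWord, ← h1.eq, ← h2]

theorem atom_one : M.atom 1 = 1 :=
  M.eq_one_of_wordLength_eq_zero (M.atom_mem 1) (by
    rw [wordLength_atom, CoxeterSystem.length_one])

theorem isArtinAtom_atom (w : M.Group) : M.IsArtinAtom (M.atom w) :=
  ⟨M.atom_mem w, by rw [wordLength_atom, artinProj_atom]⟩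

section Finite

variable [Finite M.Group]

/-- A consequence of Matsumoto's theorem. -/
theorem atom_wordProd {ω : List B} (hω : M.toCoxeterSystem.IsReduced ω) :
    M.atom (M.toCoxeterSystem.wordProd ω) = M.positiveWord ω := by
  obtain ⟨h1, h2⟩ := (M.toCoxeterSystem.exists_isReduced
    (M.toCoxeterSystem.wordProd ω)).choose_spec
  exact h1.map_prod_eq _ (CoxeterSystem.coxeterMatrix_ne_zero M.toCoxeterSystem) M.artinGen
    M.artinGen_braid hω h2.symm

theorem atom_mul {x y : M.Group} (h : M.toCoxeterSystem.IsAdditive x y) :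
    M.atom (x * y) = M.atom x * M.atom y := by
  obtain ⟨ω, hω, rfl⟩ := M.toCoxeterSystem.exists_isReduced x
  obtain ⟨ω', hω', rfl⟩ := M.toCoxeterSystem.exists_isReduced y
  have hr : M.toCoxeterSystem.IsReduced (ω ++ ω') := by
    rw [CoxeterSystem.IsReduced, CoxeterSystem.wordProd_append, h, hω.eq, hω'.eq,
      List.length_append]
  rw [← CoxeterSystem.wordProd_append, M.atom_wordProd hr, M.atom_wordProd hω,
    M.atom_wordProd hω', positiveWord_append]

theorem atom_simple (i : B) : M.atom (M.toCoxeterSystem.simple i) = M.artinGen i := by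
  have h : M.toCoxeterSystem.IsReduced [i] := by
    rw [CoxeterSystem.IsReduced, CoxeterSystem.wordProd_singleton, CoxeterSystem.length_simple]
    rfl
  have := M.atom_wordProd h
  rwa [CoxeterSystem.wordProd_singleton, positiveWord, List.map_singleton,
    List.prod_singleton] at this

theorem isArtinAtom_iff {A : M.ArtinGroup} : M.IsArtinAtom A ↔ A = M.atom (M.artinProj A) := by
  constructor
  · rintro ⟨h1, h2⟩
    obtain ⟨ω, rfl⟩ := M.exists_positiveWord h1
    rw [wordLength_positiveWord, artinProj_positiveWord] at h2
    rw [artinProj_positiveWord, M.atom_wordProd h2.symm]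
  · intro h
    rw [h]
    exact M.isArtinAtom_atom _

/-- The longest element of the Coxeter group. -/
noncomputable def longest : M.Group := M.artinProj M.garside

theorem isLongest : M.toCoxeterSystem.IsLongest M.longest := M.garside_spec.2

theorem garside_eq : M.garside = M.atom M.longest := M.isArtinAtom_iff.1 M.garside_spec.1

/-- The action of positive words on normal sequences depends only on the element of the Artin group
that they represent. -/
theorem normalMul_prod_eq {ω ω' : List B} (h : M.positiveWord ω = M.positiveWord ω') :
    (ω.map fun i => M.toCoxeterSystem.normalMul (M.toCoxeterSystem.simple i)).prod =
      (ω'.map fun i => M.toCoxeterSystem.normalMul (M.toCoxeterSystem.simple i)).prod := by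
  set cs := M.toCoxeterSystem with hcs
  have hL := M.isLongest
  set w₀ := M.longest
  set d := cs.normalMul w₀ with hd
  -- The square of the action of the longest element commutes with the action.
  have hcomm : ∀ x : M.Group, Commute (d * d) (cs.normalMul x) := by
    intro x
    have h1 : w₀ * (w₀ * x * w₀) * w₀ = x := by
      rw [mul_assoc, mul_assoc, hL.mul_self, mul_one, ← mul_assoc, hL.mul_self, one_mul]
    rw [Commute, SemiconjBy, mul_assoc, hL.normalMul_comm, ← mul_assoc, hL.normalMul_comm, h1,
      mul_assoc]
  let E := Submonoid.centralizer {d * d}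
  have hmem : ∀ x : M.Group, cs.normalMul x ∈ E := by
    intro x
    rw [Submonoid.mem_centralizer_iff]
    rintro _ rfl
    exact hcomm x
  let f : B → E := fun i => ⟨cs.normalMul (cs.simple i), hmem _⟩
  have hval : ∀ ω : List B, (((ω.map f).prod : E) : Function.End _) =
      (ω.map fun i => cs.normalMul (cs.simple i)).prod := by
    intro ω
    rw [Submonoid.coe_list_prod, List.map_map]
    rfl
  rw [← hval, ← hval]
  congr 1
  refine map_prod_eq_of_positiveWord_eq (M := M)
    (⟨d * d, E.mul_mem (hmem w₀) (hmem w₀)⟩ : E) ?_ ?_ f ?_ ?_ h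
  · intro x
    exact Subtype.ext (Submonoid.mem_centralizer_iff.1 x.2 _ rfl)
  · intro x y hxy
    have h1 : d * d * x.1 = d * d * y.1 := congrArg Subtype.val hxy
    refine Subtype.ext (funext fun a => hL.normalMul_injective (hL.normalMul_injective ?_))
    exact congrFun h1 a
  · intro i j
    refine Subtype.ext ?_
    rw [hval, hval]
    rcases eq_or_ne i j with rfl | hij
    · rfl
    rw [← cs.normalMul_wordProd (cs.isReduced_alternatingWord hij le_rfl),
      ← cs.normalMul_wordProd (cs.isReduced_alternatingWord hij.symm le_rfl),
      cs.wordProd_braidWord_eq]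
  · intro i
    have h1 : cs.normalMul (cs.simple i) * cs.normalMul ((cs.simple i)⁻¹ * w₀) = d := by
      rw [← cs.normalMul_mul (hL.isAdditive_inv_mul _), mul_inv_cancel_left]
    have h2 : cs.normalMul (w₀ * (cs.simple i)⁻¹) * cs.normalMul (cs.simple i) = d := by
      have := hL.isAdditive_mul_right (cs.simple i)⁻¹
      rw [inv_inv] at this
      rw [← cs.normalMul_mul this, inv_mul_cancel_right]
    refine ⟨⟨_, E.mul_mem (hmem ((cs.simple i)⁻¹ * w₀)) (hmem w₀)⟩,
      ⟨_, E.mul_mem (hmem w₀) (hmem (w₀ * (cs.simple i)⁻¹))⟩,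
      Subtype.ext ?_, Subtype.ext ?_⟩
    · change cs.normalMul (cs.simple i) * (cs.normalMul ((cs.simple i)⁻¹ * w₀) * d) = d * d
      rw [← mul_assoc, h1]
    · change d * cs.normalMul (w₀ * (cs.simple i)⁻¹) * cs.normalMul (cs.simple i) = d * d
      rw [mul_assoc, h2]

end Finite

end CoxeterMatrix

/-! ### Greatest atoms and powers of the Garside element -/

namespace CoxeterMatrix

variable {B : Type*} (M : CoxeterMatrix B)

variable {M} in
theorem Prefix.trans {x y z : M.ArtinGroup} (h1 : M.Prefix x y) (h2 : M.Prefix y z) :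
    M.Prefix x z := by
  obtain ⟨a, ha, rfl⟩ := h1
  obtain ⟨b, hb, rfl⟩ := h2
  exact ⟨a * b, M.artinMonoid.mul_mem ha hb, mul_assoc _ _ _⟩

theorem prefix_mul (x : M.ArtinGroup) {y : M.ArtinGroup} (hy : y ∈ M.artinMonoid) :
    M.Prefix x (x * y) := ⟨y, hy, rfl⟩

variable {M} in
theorem Prefix.mul_left {x y : M.ArtinGroup} (h : M.Prefix x y) (z : M.ArtinGroup) :
    M.Prefix (z * x) (z * y) := by
  obtain ⟨a, ha, rfl⟩ := h
  exact ⟨a, ha, (mul_assoc _ _ _).symm⟩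

section Finite

variable [Finite M.Group]

open Classical in
/-- The sequence of factors of the greedy normal form of a positive element, continued by `1`; the
value at other elements is irrelevant. It is obtained by letting a positive word act on the constant
sequence `1`. -/
noncomputable def normalSeq (g : M.ArtinGroup) : ℕ → M.Group :=
  if h : ∃ ω, M.positiveWord ω = g then
    ((h.choose.map fun i => M.toCoxeterSystem.normalMul (M.toCoxeterSystem.simple i)).prod
      ⟨fun _ => 1, CoxeterSystem.isNormalSeq_one⟩).1
  else fun _ => 1

theorem normalSeq_positiveWord (ω : List B) : M.normalSeq (M.positiveWord ω) =
    ((ω.map fun i => M.toCoxeterSystem.normalMul (M.toCoxeterSystem.simple i)).prod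
      ⟨fun _ => 1, CoxeterSystem.isNormalSeq_one⟩).1 := by
  have h : ∃ ω', M.positiveWord ω' = M.positiveWord ω := ⟨ω, rfl⟩
  rw [normalSeq, dif_pos h, M.normalMul_prod_eq h.choose_spec]

theorem normalSeq_one : M.normalSeq 1 = fun _ => 1 := M.normalSeq_positiveWord []

theorem normalSeq_atom_mul (w : M.Group) {h : M.ArtinGroup} (hh : h ∈ M.artinMonoid) :
    M.normalSeq (M.atom w * h) = M.toCoxeterSystem.leftMul w (M.normalSeq h) := by
  obtain ⟨ρ, rfl⟩ := M.exists_positiveWord hh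
  obtain ⟨ω, hω, rfl⟩ := M.toCoxeterSystem.exists_isReduced w
  rw [M.atom_wordProd hω, ← positiveWord_append, normalSeq_positiveWord, List.map_append,
    List.prod_append, ← CoxeterSystem.normalMul_wordProd _ hω, normalSeq_positiveWord]
  rfl

variable {M} in
theorem positive_induction {p : ∀ x, x ∈ M.artinMonoid → Prop} (one : p 1 M.artinMonoid.one_mem)
    (mul : ∀ i x (hx : x ∈ M.artinMonoid), p x hx → p (M.atom (M.toCoxeterSystem.simple i) * x)
      (M.artinMonoid.mul_mem (M.atom_mem _) hx))
    {x : M.ArtinGroup} (hx : x ∈ M.artinMonoid) : p x hx := by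
  obtain ⟨ω, rfl⟩ := M.exists_positiveWord hx
  induction ω with
  | nil => exact one
  | cons i ω ih =>
    have := mul i _ (M.positiveWord_mem ω) (ih _)
    simp only [M.atom_simple, ← positiveWord_cons] at this
    exact this

/-- Splitting off the first factor shifts the normal sequence. -/
theorem exists_eq_atom_mul {g : M.ArtinGroup} (hg : g ∈ M.artinMonoid) :
    ∃ h ∈ M.artinMonoid, g = M.atom (M.normalSeq g 0) * h ∧
      M.normalSeq h = fun n => M.normalSeq g (n + 1) := by
  induction hg using positive_induction with
  | one => exact ⟨1, M.artinMonoid.one_mem, by rw [normalSeq_one, atom_one, mul_one],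
      by rw [normalSeq_one]⟩
  | mul i x hx ih =>
    obtain ⟨h, hh, hxh, hn⟩ := ih
    set cs := M.toCoxeterSystem
    set a := M.normalSeq x 0
    refine ⟨M.atom (cs.tail (cs.simple i) a) * h, M.artinMonoid.mul_mem (M.atom_mem _) hh, ?_, ?_⟩
    · rw [M.normalSeq_atom_mul _ hx, CoxeterSystem.leftMul_zero]
      change _ = M.atom (cs.head (cs.simple i) a) * _
      rw [CoxeterSystem.head, M.atom_mul (cs.isAdditive_transfer _ _), mul_assoc,
        ← mul_assoc (M.atom (cs.transfer _ _)), ← M.atom_mul (cs.isAdditive_transfer_tail _ _),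
        cs.transfer_mul_tail, ← hxh]
    · funext n
      rw [M.normalSeq_atom_mul _ hh, M.normalSeq_atom_mul _ hx, CoxeterSystem.leftMul_succ, hn]

theorem atom_prefix_atom {v w : M.Group} (h : M.toCoxeterSystem.WeakLE v w) :
    M.Prefix (M.atom v) (M.atom w) :=
  ⟨_, M.atom_mem (v⁻¹ * w), by rw [← M.atom_mul h.isAdditive, mul_inv_cancel_left]⟩

theorem atom_prefix_iff {w : M.Group} {g : M.ArtinGroup} (hg : g ∈ M.artinMonoid) :
    M.Prefix (M.atom w) g ↔ M.toCoxeterSystem.WeakLE w (M.normalSeq g 0) := by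
  constructor
  · rintro ⟨z, hz, rfl⟩
    rw [M.normalSeq_atom_mul w hz]
    exact CoxeterSystem.weakLE_head _ _ _
  · intro h
    obtain ⟨z, hz, he, -⟩ := M.exists_eq_atom_mul hg
    refine (M.atom_prefix_atom h).trans ?_
    nth_rw 2 [he]
    exact M.prefix_mul _ hz

theorem normalSeq_atom (w : M.Group) : M.normalSeq (M.atom w) 0 = w := by
  rw [← mul_one (M.atom w), M.normalSeq_atom_mul w M.artinMonoid.one_mem, normalSeq_one,
    CoxeterSystem.leftMul_zero, CoxeterSystem.head_one_right]

theorem atom_prefix_atom_iff {v w : M.Group} :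
    M.Prefix (M.atom v) (M.atom w) ↔ M.toCoxeterSystem.WeakLE v w := by
  rw [M.atom_prefix_iff (M.atom_mem w), normalSeq_atom]

theorem isAlpha_iff {g A : M.ArtinGroup} (hg : g ∈ M.artinMonoid) :
    M.IsAlpha g A ↔ A = M.atom (M.normalSeq g 0) := by
  have h0 := (M.atom_prefix_iff hg).2 (CoxeterSystem.WeakLE.refl (M.normalSeq g 0))
  constructor
  · rintro ⟨h1, h2, h3⟩
    have h4 := h3 _ (M.isArtinAtom_atom _) h0
    rw [M.isArtinAtom_iff.1 h1] at h2 h4 ⊢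
    rw [atom_prefix_atom_iff] at h4
    rw [atom_prefix_iff M hg] at h2
    rw [h2.antisymm h4]
  · rintro rfl
    refine ⟨M.isArtinAtom_atom _, h0, fun A hA hAg => ?_⟩
    rw [M.isArtinAtom_iff.1 hA] at hAg ⊢
    rwa [atom_prefix_atom_iff, ← atom_prefix_iff M hg]

theorem normalSeq_eq_one_of_mul {x h : M.ArtinGroup} (hx : x ∈ M.artinMonoid)
    (hh : h ∈ M.artinMonoid) {n : ℕ} (hn : M.normalSeq (x * h) n = 1) :
    M.normalSeq h n = 1 := by
  induction hx using positive_induction with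
  | one => rwa [one_mul] at hn
  | mul i x hx ih =>
    rw [mul_assoc, M.normalSeq_atom_mul _ (M.artinMonoid.mul_mem hx hh)] at hn
    exact ih (M.toCoxeterSystem.leftMul_eq_one hn)

theorem eq_one_of_normalSeq_zero {g : M.ArtinGroup} (hg : g ∈ M.artinMonoid)
    (h : M.normalSeq g 0 = 1) : g = 1 := by
  induction hg using positive_induction with
  | one => rfl
  | mul i x hx _ =>
    have h1 := (M.atom_prefix_iff (M.artinMonoid.mul_mem (M.atom_mem _) hx)).1
      (M.prefix_mul (M.atom (M.toCoxeterSystem.simple i)) hx)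
    rw [h] at h1
    have h2 := h1.length_le
    rw [CoxeterSystem.length_simple, CoxeterSystem.length_one] at h2
    omega

/-- The atoms `r` for which the atom of `d` is a prefix of `y * r` are closed under common prefixes.
This replaces the existence of least common multiples. -/
theorem exists_common_prefix {d : M.Group} {y x x' : M.ArtinGroup} (hy : y ∈ M.artinMonoid)
    (hx : x ∈ M.artinMonoid) (hx' : x' ∈ M.artinMonoid) (h : M.Prefix (M.atom d) (y * x))
    (h' : M.Prefix (M.atom d) (y * x')) :
    ∃ r, M.Prefix (M.atom r) x ∧ M.Prefix (M.atom r) x' ∧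
      M.Prefix (M.atom d) (y * M.atom r) := by
  induction hy using positive_induction generalizing d with
  | one =>
    rw [one_mul] at h h'
    exact ⟨d, h, h', by rw [one_mul]; exact (M.atom_prefix_atom_iff).2 (.refl d)⟩
  | mul i y hy ih =>
    have m1 := M.artinMonoid.mul_mem hy hx
    have m2 := M.artinMonoid.mul_mem hy hx'
    have ms := M.atom_mem (M.toCoxeterSystem.simple i)
    rw [mul_assoc, M.atom_prefix_iff (M.artinMonoid.mul_mem ms m1),
      M.normalSeq_atom_mul _ m1] at h
    rw [mul_assoc, M.atom_prefix_iff (M.artinMonoid.mul_mem ms m2),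
      M.normalSeq_atom_mul _ m2] at h'
    obtain ⟨e, he1, he2, he⟩ := CoxeterSystem.exists_meet (cs := M.toCoxeterSystem)
      (M.normalSeq (y * x) 0) (M.normalSeq (y * x') 0)
    obtain ⟨r, hr1, hr2, hr⟩ := ih ((M.atom_prefix_iff m1).2 he1) ((M.atom_prefix_iff m2).2 he2)
    have m3 := M.artinMonoid.mul_mem hy (M.atom_mem r)
    refine ⟨r, hr1, hr2, ?_⟩
    rw [mul_assoc, M.atom_prefix_iff (M.artinMonoid.mul_mem ms m3), M.normalSeq_atom_mul _ m3]
    exact (M.toCoxeterSystem.weakLE_head_of_meet he h h').trans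
      (M.toCoxeterSystem.head_mono ((M.atom_prefix_iff m3).1 hr))

theorem garside_mem : M.garside ∈ M.artinMonoid := by
  rw [garside_eq]
  exact M.atom_mem _

theorem garside_mul_atom (w : M.Group) :
    M.garside * M.atom w = M.atom (M.longest * w * M.longest) * M.garside := by
  have hL := M.isLongest
  set w₀ := M.longest
  have e1 : (w₀ * w * w₀) * (w₀ * w⁻¹) = w₀ := by
    rw [mul_assoc, ← mul_assoc w₀ w₀, hL.mul_self, one_mul, mul_inv_cancel_right]
  have a2 : M.toCoxeterSystem.IsAdditive (w₀ * w⁻¹) w := by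
    simpa using hL.isAdditive_mul_right w⁻¹
  have a1 : M.toCoxeterSystem.IsAdditive (w₀ * w * w₀) (w₀ * w⁻¹) := by
    have := hL.length_mul_left w⁻¹
    rw [CoxeterSystem.length_inv] at this
    rw [CoxeterSystem.IsAdditive, e1, hL.length_conj, this]
  have k1 : M.atom (w₀ * w * w₀) * M.atom (w₀ * w⁻¹) = M.garside := by
    rw [← M.atom_mul a1, e1, garside_eq]
  have k2 : M.atom (w₀ * w⁻¹) * M.atom w = M.garside := by
    rw [← M.atom_mul a2, inv_mul_cancel_right, garside_eq]
  rw [← k2, ← mul_assoc, k1, k2]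

theorem garside_conj_atom (w : M.Group) :
    M.garside * M.atom w * M.garside⁻¹ = M.atom (M.longest * w * M.longest) := by
  rw [garside_mul_atom, mul_inv_cancel_right]

theorem garside_inv_conj_atom (w : M.Group) :
    M.garside⁻¹ * M.atom w * M.garside = M.atom (M.longest * w * M.longest) := by
  have h : M.longest * (M.longest * w * M.longest) * M.longest = w := by
    rw [mul_assoc, mul_assoc, M.isLongest.mul_self, mul_one, ← mul_assoc, M.isLongest.mul_self,
      one_mul]
  have := M.garside_mul_atom (M.longest * w * M.longest)
  rw [h] at this
  rw [mul_assoc, ← this, inv_mul_cancel_left]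

theorem garside_conj_mem {x : M.ArtinGroup} (hx : x ∈ M.artinMonoid) (e : ℤ) :
    M.garside ^ e * x * (M.garside ^ e)⁻¹ ∈ M.artinMonoid := by
  have key : ∀ d : M.ArtinGroup, (∀ w, d * M.atom w * d⁻¹ ∈ M.artinMonoid) →
      ∀ x ∈ M.artinMonoid, d * x * d⁻¹ ∈ M.artinMonoid := by
    intro d hd x hx
    induction hx using positive_induction with
    | one => simp [M.artinMonoid.one_mem]
    | mul i x hx ih =>
      have := M.artinMonoid.mul_mem (hd (M.toCoxeterSystem.simple i)) ih
      rwa [show d * M.atom (M.toCoxeterSystem.simple i) * d⁻¹ * (d * x * d⁻¹) =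
        d * (M.atom (M.toCoxeterSystem.simple i) * x) * d⁻¹ by group] at this
  have h1 := key M.garside fun w => by rw [garside_conj_atom]; exact M.atom_mem _
  have h2 := key M.garside⁻¹ fun w => by
    rw [inv_inv, garside_inv_conj_atom]; exact M.atom_mem _
  induction e using Int.induction_on with
  | zero => simpa using hx
  | succ n ih =>
    have := h1 _ ih
    rwa [show M.garside * (M.garside ^ (n : ℤ) * x * (M.garside ^ (n : ℤ))⁻¹) * M.garside⁻¹ =
      M.garside ^ ((n : ℤ) + 1) * x * (M.garside ^ ((n : ℤ) + 1))⁻¹ by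
        rw [add_comm, zpow_add, zpow_one]; group] at this
  | pred n ih =>
    have := h2 _ ih
    rwa [show M.garside⁻¹ * (M.garside ^ (-(n : ℤ)) * x * (M.garside ^ (-(n : ℤ)))⁻¹) *
        M.garside⁻¹⁻¹ = M.garside ^ (-(n : ℤ) - 1) * x * (M.garside ^ (-(n : ℤ) - 1))⁻¹ by
      rw [sub_eq_add_neg, add_comm, zpow_add, zpow_neg_one]; group] at this

theorem garside_conj_mem' {x : M.ArtinGroup} (hx : x ∈ M.artinMonoid) (e : ℤ) :
    (M.garside ^ e)⁻¹ * x * M.garside ^ e ∈ M.artinMonoid := by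
  have := M.garside_conj_mem hx (-e)
  rwa [zpow_neg, inv_inv] at this

theorem garside_pow_mem (n : ℕ) : M.garside ^ n ∈ M.artinMonoid :=
  M.artinMonoid.pow_mem M.garside_mem n

theorem normalSeq_garside_pow (n : ℕ) : M.normalSeq (M.garside ^ n) n = 1 := by
  induction n with
  | zero => rw [pow_zero, normalSeq_one]
  | succ n ih =>
    have hn : M.toCoxeterSystem.IsNormalSeq (M.normalSeq (M.garside ^ n)) := by
      obtain ⟨ω, hω⟩ := M.exists_positiveWord (M.garside_pow_mem n)
      rw [← hω, normalSeq_positiveWord]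
      exact Subtype.property _
    rw [pow_succ']
    nth_rw 1 [garside_eq]
    rw [M.normalSeq_atom_mul _ (M.garside_pow_mem n), M.isLongest.leftMul_succ hn, ih]

/-- A positive element with at most `n` factors in its normal form divides `Δ ^ n`. -/
theorem exists_mul_eq_garside_pow {x : M.ArtinGroup} (hx : x ∈ M.artinMonoid) {n : ℕ}
    (h : M.normalSeq x n = 1) : ∃ z ∈ M.artinMonoid, x * z = M.garside ^ n := by
  induction n generalizing x with
  | zero =>
    exact ⟨1, M.artinMonoid.one_mem, by rw [M.eq_one_of_normalSeq_zero hx h, mul_one, pow_zero]⟩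
  | succ n ih =>
    obtain ⟨y, hy, hxy, hn⟩ := M.exists_eq_atom_mul hx
    set a := M.normalSeq x 0
    obtain ⟨z, hz, hyz⟩ := ih hy ((congrFun hn n).trans h)
    have hc : M.atom a * M.atom (a⁻¹ * M.longest) = M.garside := by
      rw [← M.atom_mul (M.isLongest.isAdditive_inv_mul a), mul_inv_cancel_left, garside_eq]
    refine ⟨z * ((M.garside ^ (n : ℤ))⁻¹ * M.atom (a⁻¹ * M.longest) * M.garside ^ (n : ℤ)),
      M.artinMonoid.mul_mem hz (M.garside_conj_mem' (M.atom_mem _) n), ?_⟩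
    rw [hxy, mul_assoc, ← mul_assoc y, hyz, zpow_natCast, mul_assoc, mul_inv_cancel_left,
      ← mul_assoc, hc, pow_succ']

theorem normalSeq_eq_one_of_mul_eq {x z : M.ArtinGroup} (hz : z ∈ M.artinMonoid)
    (hx : x ∈ M.artinMonoid) {n : ℕ} (h : z * x = M.garside ^ n) : M.normalSeq x n = 1 :=
  M.normalSeq_eq_one_of_mul hz hx (by rw [h, normalSeq_garside_pow])

/-- A divisor of `Δ ^ n` has at most `n` factors in its normal form. The normal form is only known
to grow under left multiplication, so the complementary factor is moved to the left past `Δ ^ n`.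
-/
theorem normalSeq_eq_one_of_mul_eq' {x z : M.ArtinGroup} (hx : x ∈ M.artinMonoid)
    (hz : z ∈ M.artinMonoid) {n : ℕ} (h : x * z = M.garside ^ n) : M.normalSeq x n = 1 := by
  refine M.normalSeq_eq_one_of_mul_eq (M.garside_conj_mem hz n) hx ?_
  rw [zpow_natCast, ← h]
  group

theorem normalSeq_conj_eq_one {x : M.ArtinGroup} (hx : x ∈ M.artinMonoid) (e : ℤ) {n : ℕ}
    (h : M.normalSeq x n = 1) :
    M.normalSeq (M.garside ^ e * x * (M.garside ^ e)⁻¹) n = 1 := by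
  obtain ⟨z, hz, hxz⟩ := M.exists_mul_eq_garside_pow hx h
  refine M.normalSeq_eq_one_of_mul_eq' (M.garside_conj_mem hx e) (M.garside_conj_mem hz e) ?_
  rw [show M.garside ^ e * x * (M.garside ^ e)⁻¹ * (M.garside ^ e * z * (M.garside ^ e)⁻¹) =
    M.garside ^ e * (x * z) * (M.garside ^ e)⁻¹ by group, hxz]
  group

end Finite

end CoxeterMatrix

/-! ### Normal forms, special representatives and distances -/

namespace CoxeterMatrix

variable {B : Type*} (M : CoxeterMatrix B)

variable {M} in
theorem IsNormalForm.isArtinAtom {L : List M.ArtinGroup} (h : M.IsNormalForm L) :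
    ∀ A ∈ L, M.IsArtinAtom A := by
  induction L with
  | nil => simp
  | cons A L ih =>
    intro A' hA'
    rcases List.mem_cons.1 hA' with rfl | hA'
    · exact h.2.1.1
    · exact ih h.2.2 A' hA'

variable {M} in
theorem IsNormalForm.prod_mem {L : List M.ArtinGroup} (h : M.IsNormalForm L) :
    L.prod ∈ M.artinMonoid :=
  M.artinMonoid.list_prod_mem fun A hA => (h.isArtinAtom A hA).1

/-- Replacing a final segment of a normal form by a normal form of one of its prefixes leaves a
normal form. -/
theorem isNormalForm_append {L₁ L₂ L₃ : List M.ArtinGroup} (h : M.IsNormalForm (L₁ ++ L₂))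
    (h₃ : M.IsNormalForm L₃) (hp : M.Prefix L₃.prod L₂.prod) : M.IsNormalForm (L₁ ++ L₃) := by
  induction L₁ with
  | nil => exact h₃
  | cons A L₁ ih =>
    have ih := ih h.2.2
    obtain ⟨h1, h2, -⟩ := h
    refine ⟨h1, ⟨h2.1, ?_, fun A' hA' hp' => h2.2.2 A' hA' (hp'.trans ?_)⟩, ih⟩
    · change M.Prefix A (A :: (L₁ ++ L₃)).prod
      rw [List.prod_cons]
      exact M.prefix_mul A ih.prod_mem
    · change M.Prefix (A :: (L₁ ++ L₃)).prod (A :: (L₁ ++ L₂)).prod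
      rw [List.prod_cons, List.prod_cons, List.prod_append, List.prod_append]
      exact (hp.mul_left _).mul_left _

theorem one_prefix {x : M.ArtinGroup} (hx : x ∈ M.artinMonoid) : M.Prefix 1 x :=
  ⟨x, hx, (one_mul x).symm⟩

variable {M} in
theorem IsNormalForm.append_right {L₁ L₂ : List M.ArtinGroup}
    (h : M.IsNormalForm (L₁ ++ L₂)) : M.IsNormalForm L₂ := by
  induction L₁ with
  | nil => exact h
  | cons A L₁ ih => exact ih h.2.2

variable {M} in
theorem IsNormalForm.append_left {L₁ L₂ : List M.ArtinGroup}
    (h : M.IsNormalForm (L₁ ++ L₂)) : M.IsNormalForm L₁ := by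
  have := M.isNormalForm_append h (L₃ := []) trivial (M.one_prefix h.append_right.prod_mem)
  rwa [List.append_nil] at this

theorem closure_range_artinGen : Subgroup.closure (Set.range M.artinGen) = ⊤ :=
  PresentedGroup.closure_range_of M.artinRelations

theorem wordLength_conj {x : M.ArtinGroup} (hx : x ∈ M.artinMonoid) (d : M.ArtinGroup)
    (h : d * x * d⁻¹ ∈ M.artinMonoid) : M.wordLength (d * x * d⁻¹) = M.wordLength x := by
  obtain ⟨φ, hφ⟩ := M.exists_degree
  obtain ⟨ω, rfl⟩ := M.exists_positiveWord hx
  obtain ⟨ω', h'⟩ := M.exists_positiveWord h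
  have h1 := congrArg φ h'
  rw [map_mul, map_mul, map_inv, mul_right_comm, mul_inv_cancel, one_mul, hφ, hφ] at h1
  rw [← h', wordLength_positiveWord, wordLength_positiveWord]
  exact_mod_cast Multiplicative.ofAdd.injective h1

theorem wordLength_ne_zero {x : M.ArtinGroup} (hx : x ∈ M.artinMonoid) (h : x ≠ 1) :
    M.wordLength x ≠ 0 := fun h0 => h (M.eq_one_of_wordLength_eq_zero hx h0)

variable {M} in
theorem IsNormalForm.length_le_wordLength {L : List M.ArtinGroup} (h : M.IsNormalForm L) :
    L.length ≤ M.wordLength L.prod := by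
  induction L with
  | nil => simp
  | cons A L ih =>
    have h0 := M.wordLength_ne_zero h.2.1.1.1 h.1
    have := ih h.2.2
    rw [List.prod_cons, M.wordLength_mul h.2.1.1.1 h.2.2.prod_mem, List.length_cons]
    omega

section Finite

variable [Finite M.Group]

variable {M} in
theorem IsNormalForm.normalSeq_eq_one_iff {L : List M.ArtinGroup} (h : M.IsNormalForm L) (n : ℕ) :
    M.normalSeq L.prod n = 1 ↔ L.length ≤ n := by
  induction L generalizing n with
  | nil => simp [normalSeq_one]
  | cons A L ih =>
    have hm := h.prod_mem
    have hA := (M.isAlpha_iff hm).1 h.2.1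
    cases n with
    | zero =>
      refine iff_of_false (fun h0 => ?_) (Nat.not_succ_le_zero _)
      rw [h0, atom_one] at hA
      exact h.1 hA
    | succ n =>
      obtain ⟨y, -, hy, hn⟩ := M.exists_eq_atom_mul hm
      rw [← hA, List.prod_cons] at hy
      rw [← mul_left_cancel hy] at hn
      have := ih h.2.2 n
      rw [hn] at this
      rw [List.length_cons, Nat.succ_le_succ_iff]
      exact this

theorem exists_isNormalForm {x : M.ArtinGroup} (hx : x ∈ M.artinMonoid) :
    ∃ L, M.IsNormalForm L ∧ L.prod = x := by
  induction hn : M.wordLength x using Nat.strong_induction_on generalizing x with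
  | _ n ih =>
  by_cases h0 : M.normalSeq x 0 = 1
  · exact ⟨[], trivial, (M.eq_one_of_normalSeq_zero hx h0).symm⟩
  · obtain ⟨y, hy, hxy, -⟩ := M.exists_eq_atom_mul hx
    have hl := M.wordLength_mul (M.atom_mem (M.normalSeq x 0)) hy
    rw [← hxy, wordLength_atom] at hl
    have h1 : M.toCoxeterSystem.length (M.normalSeq x 0) ≠ 0 := fun h =>
      h0 (M.toCoxeterSystem.length_eq_zero_iff.1 h)
    obtain ⟨L, hL, rfl⟩ := ih _ (by omega) hy rfl
    refine ⟨M.atom (M.normalSeq x 0) :: L, ⟨fun h => h0 (M.atom_injective (h.trans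
      M.atom_one.symm)), ?_, hL⟩, hxy.symm⟩
    rw [List.prod_cons, ← hxy, isAlpha_iff M hx]

theorem exists_mul_eq_garside_pow' {x : M.ArtinGroup} (hx : x ∈ M.artinMonoid) :
    ∃ n, ∃ z ∈ M.artinMonoid, x * z = M.garside ^ n := by
  obtain ⟨L, hL, rfl⟩ := M.exists_isNormalForm hx
  exact ⟨_, M.exists_mul_eq_garside_pow hx ((hL.normalSeq_eq_one_iff _).2 le_rfl)⟩

theorem exists_garside_pow_mul_mem (g : M.ArtinGroup) :
    ∃ n : ℕ, M.garside ^ n * g ∈ M.artinMonoid := by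
  have hg : g ∈ Subgroup.closure (Set.range M.artinGen) := by
    rw [closure_range_artinGen]; exact Subgroup.mem_top g
  induction hg using Subgroup.closure_induction with
  | mem x hx => exact ⟨0, by rw [pow_zero, one_mul]; exact Submonoid.subset_closure hx⟩
  | one => exact ⟨0, by rw [pow_zero, one_mul]; exact M.artinMonoid.one_mem⟩
  | mul x y _ _ hx hy =>
    obtain ⟨n, hn⟩ := hx
    obtain ⟨m, hm⟩ := hy
    refine ⟨m + n, ?_⟩
    have := M.artinMonoid.mul_mem (M.garside_conj_mem hn m) hm
    rw [zpow_natCast] at this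
    rwa [show M.garside ^ m * (M.garside ^ n * x) * (M.garside ^ m)⁻¹ * (M.garside ^ m * y) =
      M.garside ^ (m + n) * (x * y) by rw [pow_add]; group] at this
  | inv x _ hx =>
    obtain ⟨n, hn⟩ := hx
    obtain ⟨k, z, hz, hxz⟩ := M.exists_mul_eq_garside_pow' hn
    refine ⟨k, ?_⟩
    have := M.artinMonoid.mul_mem (M.garside_conj_mem hz k) (M.garside_pow_mem n)
    rw [zpow_natCast] at this
    rwa [show M.garside ^ k * z * (M.garside ^ k)⁻¹ * M.garside ^ n = M.garside ^ k * x⁻¹ by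
      rw [← hxz]; group] at this

/-- A special element: positive and not divisible by `Δ`. -/
def IsSpecial (x : M.ArtinGroup) : Prop := x ∈ M.artinMonoid ∧ ¬ M.Prefix M.garside x

theorem prefix_garside_conj {x : M.ArtinGroup} (h : M.Prefix M.garside x) (e : ℤ) :
    M.Prefix M.garside (M.garside ^ e * x * (M.garside ^ e)⁻¹) := by
  obtain ⟨z, hz, rfl⟩ := h
  refine ⟨_, M.garside_conj_mem hz e, ?_⟩
  rw [← mul_assoc, ← mul_assoc, ← mul_assoc, ← zpow_add_one, ← zpow_one_add, add_comm]

variable {M} in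
theorem IsSpecial.conj {x : M.ArtinGroup} (h : M.IsSpecial x) (e : ℤ) :
    M.IsSpecial (M.garside ^ e * x * (M.garside ^ e)⁻¹) := by
  refine ⟨M.garside_conj_mem h.1 e, fun hp => h.2 ?_⟩
  have := M.prefix_garside_conj hp (-e)
  rwa [zpow_neg, inv_inv, show (M.garside ^ e)⁻¹ * (M.garside ^ e * x * (M.garside ^ e)⁻¹) *
    M.garside ^ e = x by group] at this

/-- Every positive element is a power of `Δ` times a special element. -/
theorem exists_eq_garside_pow_mul (hΔ : M.garside ≠ 1) {x : M.ArtinGroup}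
    (hx : x ∈ M.artinMonoid) : ∃ (k : ℕ) (z : M.ArtinGroup),
      M.IsSpecial z ∧ x = M.garside ^ k * z := by
  induction hn : M.wordLength x using Nat.strong_induction_on generalizing x with
  | _ n ih =>
  by_cases hp : M.Prefix M.garside x
  · obtain ⟨y, hy, rfl⟩ := hp
    have hl := M.wordLength_mul M.garside_mem hy
    have h0 := M.wordLength_ne_zero M.garside_mem hΔ
    obtain ⟨k, z, hz, rfl⟩ := ih _ (by omega) hy rfl
    exact ⟨k + 1, z, hz, by rw [pow_succ', mul_assoc]⟩
  · exact ⟨0, x, ⟨hx, hp⟩, by rw [pow_zero, one_mul]⟩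

theorem exists_isSpecial_garside_zpow_mul (hΔ : M.garside ≠ 1) (g : M.ArtinGroup) :
    ∃ e : ℤ, M.IsSpecial (M.garside ^ e * g) := by
  obtain ⟨n, hn⟩ := M.exists_garside_pow_mul_mem g
  obtain ⟨k, z, hz, he⟩ := M.exists_eq_garside_pow_mul hΔ hn
  refine ⟨n - k, ?_⟩
  rwa [sub_eq_neg_add, zpow_add, zpow_neg, zpow_natCast, zpow_natCast, mul_assoc, he,
    inv_mul_cancel_left]

theorem mk_mul_garside_zpow (g : M.ArtinGroup) (e : ℤ) :
    ((g * M.garside ^ e : M.ArtinGroup) : M.Vertex) = g :=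
  QuotientGroup.mk_mul_of_mem g (Subgroup.zpow_mem_zpowers _ e)

/-- Every vertex has a special representative. -/
theorem exists_isSpecial_mk_eq (hΔ : M.garside ≠ 1) (v : M.Vertex) :
    ∃ x, M.IsSpecial x ∧ (x : M.Vertex) = v := by
  obtain ⟨e, he⟩ := M.exists_isSpecial_garside_zpow_mul hΔ v.out
  have h1 := he.conj (-e)
  rw [zpow_neg, inv_inv, inv_mul_cancel_left] at h1
  exact ⟨_, h1, by rw [mk_mul_garside_zpow, QuotientGroup.out_eq']⟩

/-- The special representative of a vertex is unique. -/
theorem eq_of_isSpecial {x y : M.ArtinGroup} (hx : M.IsSpecial x) (hy : M.IsSpecial y)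
    (h : (x : M.Vertex) = y) : x = y := by
  have key : ∀ {x y : M.ArtinGroup}, M.IsSpecial x → M.IsSpecial y → ∀ n : ℕ,
      y = x * M.garside ^ n → x = y := by
    rintro x y hx hy n rfl
    cases n with
    | zero => rw [pow_zero, mul_one]
    | succ n =>
      refine (hy.2 ⟨M.garside⁻¹ * x * M.garside * M.garside ^ n,
        M.artinMonoid.mul_mem ?_ (M.garside_pow_mem n), ?_⟩).elim
      · simpa using M.garside_conj_mem' hx.1 1
      · rw [pow_succ']; group
  obtain ⟨e, he⟩ := Subgroup.mem_zpowers_iff.1 (QuotientGroup.eq.1 h)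
  have he : y = x * M.garside ^ e := by rw [he, mul_inv_cancel_left]
  obtain ⟨n, rfl | rfl⟩ := e.eq_nat_or_neg
  · exact key hx hy n (by rwa [zpow_natCast] at he)
  · refine (key hy hx n ?_).symm
    rw [he, zpow_neg, zpow_natCast, inv_mul_cancel_right]

variable {M} in
theorem IsNormalForm.isSpecial_prod_iff (hΔ : M.garside ≠ 1) {L : List M.ArtinGroup}
    (h : M.IsNormalForm L) : M.IsSpecial L.prod ↔ M.garside ∉ L := by
  rw [IsSpecial, and_iff_right h.prod_mem, not_iff_not]
  constructor
  · intro hp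
    rw [garside_eq, atom_prefix_iff M h.prod_mem] at hp
    cases L with
    | nil =>
      rw [List.prod_nil, normalSeq_one] at hp
      refine (hΔ ?_).elim
      rw [garside_eq, CoxeterSystem.eq_one_of_weakLE_one hp, atom_one]
    | cons A L =>
      have hA := (M.isAlpha_iff h.prod_mem).1 h.2.1
      rw [← hp.antisymm (M.isLongest.weakLE _), ← garside_eq] at hA
      rw [hA]
      exact List.mem_cons_self
  · intro hm
    induction L with
    | nil => simp at hm
    | cons A L ih =>
      rw [List.prod_cons]
      rcases List.mem_cons.1 hm with hA | hm
      · rw [← hA]; exact M.prefix_mul _ h.2.2.prod_mem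
      · obtain ⟨z, hz, he⟩ := ih h.2.2 hm
        refine ⟨M.garside⁻¹ * A * M.garside * z, M.artinMonoid.mul_mem ?_ hz, ?_⟩
        · simpa using M.garside_conj_mem' h.2.1.1.1 1
        · rw [he]; group

theorem specialForm_spec (hΔ : M.garside ≠ 1) {x : M.ArtinGroup} (hx : M.IsSpecial x) :
    M.IsNormalForm (M.specialForm x) ∧ M.garside ∉ M.specialForm x ∧
      (M.specialForm (x : M.Vertex)).prod = x := by
  have hex : ∃ L, M.IsSpecialForm (x : M.Vertex) L := by
    obtain ⟨L, hL, rfl⟩ := M.exists_isNormalForm hx.1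
    exact ⟨L, hL, (hL.isSpecial_prod_iff hΔ).1 hx, rfl⟩
  have h : M.IsSpecialForm (x : M.Vertex) (M.specialForm x) := by
    rw [specialForm, dif_pos hex]
    exact hex.choose_spec
  exact ⟨h.1, h.2.1, M.eq_of_isSpecial ((h.1.isSpecial_prod_iff hΔ).2 h.2.1) hx h.2.2⟩

theorem exists_out_inv_smul (k h : M.ArtinGroup) : ∃ e : ℤ,
    (k : M.Vertex).out⁻¹ • (h : M.Vertex) =
      (M.garside ^ e * (k⁻¹ * h) * (M.garside ^ e)⁻¹ : M.ArtinGroup) := by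
  obtain ⟨⟨d, hd⟩, he⟩ := QuotientGroup.mk_out_eq_mul (Subgroup.zpowers M.garside) k
  obtain ⟨e, rfl⟩ := Subgroup.mem_zpowers_iff.1 hd
  refine ⟨-e, ?_⟩
  rw [he, zpow_neg, inv_inv, mk_mul_garside_zpow]
  rw [mul_inv_rev, ← mul_assoc]
  rfl

/-- The word distance, computed from representatives of the vertices. -/
theorem wordDist_eq (hΔ : M.garside ≠ 1) {k h : M.ArtinGroup} (hx : M.IsSpecial (k⁻¹ * h)) :
    M.wordDist k h = M.wordLength (k⁻¹ * h) := by
  obtain ⟨e, he⟩ := M.exists_out_inv_smul k h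
  have hs := hx.conj e
  rw [wordDist, he, wordNorm, (M.specialForm_spec hΔ hs).2.2, M.wordLength_conj hx.1 _ hs.1]

/-- The atom distance, computed from representatives of the vertices. -/
theorem atomDist_le_iff (hΔ : M.garside ≠ 1) {k h : M.ArtinGroup} (hx : M.IsSpecial (k⁻¹ * h))
    (n : ℕ) : M.atomDist k h ≤ n ↔ M.normalSeq (k⁻¹ * h) n = 1 := by
  obtain ⟨e, he⟩ := M.exists_out_inv_smul k h
  have hs := hx.conj e
  obtain ⟨h1, -, h2⟩ := M.specialForm_spec hΔ hs
  rw [atomDist, he, atomNorm, ← h1.normalSeq_eq_one_iff, h2]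
  refine ⟨fun h => ?_, M.normalSeq_conj_eq_one hx.1 e⟩
  have := M.normalSeq_conj_eq_one hs.1 (-e) h
  rwa [zpow_neg, inv_inv, show ∀ d x : M.ArtinGroup, d⁻¹ * (d * x * d⁻¹) * d = x by
    intro d x; group] at this

theorem atomDist_le (hΔ : M.garside ≠ 1) {k h : M.ArtinGroup} (hx : k⁻¹ * h ∈ M.artinMonoid)
    {n : ℕ} (hn : M.normalSeq (k⁻¹ * h) n = 1) : M.atomDist k h ≤ n := by
  obtain ⟨m, z, hz, he⟩ := M.exists_eq_garside_pow_mul hΔ hx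
  have h1 : (k * M.garside ^ (m : ℤ))⁻¹ * h = z := by
    rw [mul_inv_rev, mul_assoc, he, zpow_natCast, inv_mul_cancel_left]
  rw [← M.mk_mul_garside_zpow k m, M.atomDist_le_iff hΔ (by rwa [h1]), h1]
  rw [he] at hn
  exact M.normalSeq_eq_one_of_mul (M.garside_pow_mem m) hz.1 hn

/-- Let `L₁ ++ L₂` be a normal form and let `P` be the positive element representing the inverse of
the product of `L₁` up to `Δ`. If `Δ` divides both `y * P` and `y * L₂.prod`, then it divides `y`:
otherwise `P` and `L₂.prod` have a nontrivial atom `r` as a common prefix, so that `L₁` followed by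
`r` is a normal form, too long for a divisor of `Δ ^ L₁.length`. -/
theorem not_prefix_of_isNormalForm {L₁ L₂ : List M.ArtinGroup} (h : M.IsNormalForm (L₁ ++ L₂))
    {y P : M.ArtinGroup} (hy : M.IsSpecial y) (hP : P ∈ M.artinMonoid)
    (hLP : L₁.prod * P = M.garside ^ L₁.length) (h₁ : M.Prefix M.garside (y * P)) :
    ¬ M.Prefix M.garside (y * L₂.prod) := by
  intro h₂
  rw [garside_eq] at h₁ h₂
  obtain ⟨r, hr1, hr2, hr⟩ :=
    M.exists_common_prefix hy.1 hP h.append_right.prod_mem h₁ h₂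
  have hr0 : M.atom r ≠ 1 := by
    intro h0
    rw [h0, mul_one, ← garside_eq] at hr
    exact hy.2 hr
  have hn : M.IsNormalForm [M.atom r] := by
    refine ⟨hr0, ?_, trivial⟩
    rw [List.prod_singleton]
    exact ⟨M.isArtinAtom_atom r, (M.atom_prefix_atom_iff).2 (.refl r), fun _ _ h => h⟩
  have hn' := M.isNormalForm_append h hn (by rwa [List.prod_singleton])
  obtain ⟨z, hz, rfl⟩ := hr1
  have := M.normalSeq_eq_one_of_mul_eq' (n := L₁.length) hn'.prod_mem hz (by
    rw [List.prod_append, List.prod_singleton, mul_assoc, hLP])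
  rw [hn'.normalSeq_eq_one_iff, List.length_append, List.length_singleton] at this
  omega

theorem wordLength_lt_garside {A : M.ArtinGroup} (hA : M.IsArtinAtom A) (hne : A ≠ M.garside) :
    M.wordLength A < M.wordLength M.garside := by
  rw [M.isArtinAtom_iff.1 hA, garside_eq, wordLength_atom, wordLength_atom]
  refine lt_of_le_of_ne (M.isLongest _) fun h => hne ?_
  rw [M.isArtinAtom_iff.1 hA, M.isLongest.eq_of_length_le h.ge, garside_eq]

theorem wordLength_garside_pow (n : ℕ) :
    M.wordLength (M.garside ^ n) = n * M.wordLength M.garside := by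
  induction n with
  | zero => rw [pow_zero, wordLength_one, zero_mul]
  | succ n ih => rw [pow_succ, M.wordLength_mul (M.garside_pow_mem n) M.garside_mem, ih]; ring

variable {M} in
theorem IsNormalForm.wordLength_add_length_le {L : List M.ArtinGroup} (h : M.IsNormalForm L)
    (hΔ : M.garside ∉ L) :
    M.wordLength L.prod + L.length ≤ L.length * M.wordLength M.garside := by
  induction L with
  | nil => simp [wordLength_one]
  | cons A L ih =>
    rw [List.mem_cons, not_or] at hΔ
    have h0 := M.wordLength_lt_garside h.2.1.1 (Ne.symm hΔ.1)
    have := ih h.2.2 hΔ.2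
    rw [List.prod_cons, M.wordLength_mul h.2.1.1.1 h.2.2.prod_mem, List.length_cons, add_mul,
      one_mul]
    omega

/-- A prefix of a special element has at most as many factors in its normal form. -/
theorem atomDist_le_of_mul (hΔ : M.garside ≠ 1) {k h x : M.ArtinGroup}
    (hx : x ∈ M.artinMonoid) (hy : k⁻¹ * h ∈ M.artinMonoid)
    (hyx : M.IsSpecial (k⁻¹ * (h * x))) :
    M.atomDist k h ≤ M.atomDist k (h * x : M.ArtinGroup) := by
  have h1 := (M.atomDist_le_iff hΔ hyx _).1 le_rfl
  obtain ⟨z, hz, he⟩ := M.exists_mul_eq_garside_pow hyx.1 h1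
  refine M.atomDist_le hΔ hy (M.normalSeq_eq_one_of_mul_eq' hy
    (M.artinMonoid.mul_mem hx hz) ?_)
  rw [← he]
  group

theorem eq_one_of_garside_eq_one (hΔ : M.garside = 1) (g : M.ArtinGroup) : g = 1 := by
  obtain ⟨n, hn⟩ := M.exists_garside_pow_mul_mem g
  rw [hΔ, one_pow, one_mul] at hn
  obtain ⟨ω, rfl⟩ := M.exists_positiveWord hn
  cases ω with
  | nil => rfl
  | cons i ω =>
    have h1 := M.isLongest (M.toCoxeterSystem.simple i)
    rw [← wordLength_atom, ← wordLength_atom, ← garside_eq, hΔ, wordLength_one, wordLength_atom,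
      CoxeterSystem.length_simple] at h1
    omega

end Finite

end CoxeterMatrix

/-! ### Distances to the points of a geodesic -/

theorem mainTheorem2 {S : Type*} [Finite S] (M : CoxeterMatrix S) [Finite M.Group]
    (u v w p : M.Vertex) (γ : List M.Vertex) (hγ : M.IsGeodesic v w γ) (hp : p ∈ γ)
    (hpv : p ≠ v) (hpw : p ≠ w) :
    M.atomDist u p ≤ max (M.atomDist u v) (M.atomDist u w) ∧
    M.wordDist u p < max (M.wordDist u v) (M.wordDist u w) ∧
    (M.wordDist u p : ℤ) ≤
      max (M.wordDist u v : ℤ) (M.wordDist u w : ℤ) -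
        min (M.atomDist v p : ℤ) (M.atomDist w p : ℤ) := by
  -- If `Δ = 1`, then there are no generators and only one vertex.
  by_cases hΔ : M.garside = 1
  · refine (hpv ?_).elim
    rw [← QuotientGroup.out_eq' p, ← QuotientGroup.out_eq' v,
      M.eq_one_of_garside_eq_one hΔ p.out, M.eq_one_of_garside_eq_one hΔ v.out]
  obtain ⟨g, rfl, rfl⟩ := hγ
  obtain ⟨x, hx, hxw⟩ := M.exists_isSpecial_mk_eq hΔ (g⁻¹ • w)
  obtain rfl : w = ((g * x : M.ArtinGroup) : M.Vertex) := by
    rw [← smul_inv_smul g w, ← hxw]; rfl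
  obtain ⟨hL, hΔL, hLx⟩ := M.specialForm_spec hΔ hx
  rw [CoxeterMatrix.combing, ← hxw, List.map_map, List.mem_map] at hp
  obtain ⟨L₁, hL₁, rfl⟩ := hp
  obtain ⟨L₂, hL₂⟩ := (List.mem_inits _ _).1 hL₁
  rw [← hL₂] at hL hΔL hLx
  subst hLx
  rw [List.mem_append, not_or] at hΔL
  have hm₁ := hL.append_left.prod_mem
  have hm₂ := hL.append_right.prod_mem
  -- Positive representatives of the inverses of the two halves of the geodesic.
  obtain ⟨P, hP, hLP⟩ := M.exists_mul_eq_garside_pow hm₁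
    ((hL.append_left.normalSeq_eq_one_iff _).2 le_rfl)
  obtain ⟨P', hP', hLP'⟩ := M.exists_mul_eq_garside_pow hm₂
    ((hL.append_right.normalSeq_eq_one_iff _).2 le_rfl)
  set h := g * L₁.prod with hh
  have ep : ((fun x : M.Vertex => g • x) ∘ fun L : List M.ArtinGroup => (L.prod : M.Vertex)) L₁ =
      (h : M.Vertex) := rfl
  have ev : g • M.basepoint = ((h * P : M.ArtinGroup) : M.Vertex) := by
    rw [hh, mul_assoc, hLP, ← zpow_natCast, M.mk_mul_garside_zpow]
    exact congrArg _ (mul_one g)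
  have ew : g * (L₁ ++ L₂).prod = h * L₂.prod := by rw [List.prod_append, hh, mul_assoc]
  rw [ep] at hpv hpw ⊢
  rw [ew] at hpw ⊢
  -- The distances from the two ends of the geodesic to `p`.
  have hvp : M.atomDist (g • M.basepoint) h ≤ L₁.length := by
    have e : (g • M.basepoint) = (g : M.Vertex) := congrArg _ (mul_one g)
    have e' : g⁻¹ * h = L₁.prod := by rw [hh, inv_mul_cancel_left]
    rw [e]
    refine M.atomDist_le hΔ (by rwa [e']) ?_
    rw [e', hL.append_left.normalSeq_eq_one_iff]
  have hwp : M.atomDist (h * L₂.prod : M.ArtinGroup) h ≤ L₂.length := by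
    have e' : (h * L₂.prod)⁻¹ * (h * M.garside ^ (L₂.length : ℤ)) = P' := by
      rw [zpow_natCast, ← hLP']; group
    rw [← M.mk_mul_garside_zpow h L₂.length]
    refine M.atomDist_le hΔ (by rwa [e']) ?_
    rw [e']
    exact M.normalSeq_eq_one_of_mul_eq hm₂ hP' hLP'
  have hL₁0 : 0 < L₁.length := by
    refine List.length_pos_iff.2 fun h0 => hpv ?_
    rw [hh, h0, List.prod_nil]
    rfl
  have hL₂0 : 0 < L₂.length := by
    refine List.length_pos_iff.2 fun h0 => hpw ?_
    rw [h0, List.prod_nil, mul_one]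
  -- A representative `k` of `u` for which `k⁻¹ * h` is the special representative.
  obtain ⟨e, he⟩ := M.exists_isSpecial_garside_zpow_mul hΔ (u.out⁻¹ * h)
  obtain ⟨k, rfl, hk⟩ : ∃ k : M.ArtinGroup, (k : M.Vertex) = u ∧ M.IsSpecial (k⁻¹ * h) := by
    refine ⟨u.out * M.garside ^ (-e), by rw [M.mk_mul_garside_zpow, QuotientGroup.out_eq'], ?_⟩
    rwa [mul_inv_rev, zpow_neg, inv_inv, mul_assoc]
  have hup := M.wordDist_eq hΔ hk
  have step : ∀ x ∈ M.artinMonoid, ¬ M.Prefix M.garside (k⁻¹ * h * x) →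
      M.atomDist k h ≤ M.atomDist k (h * x : M.ArtinGroup) ∧
      M.wordDist k (h * x : M.ArtinGroup) = M.wordDist k h + M.wordLength x := by
    intro x hx hnp
    have hs : M.IsSpecial (k⁻¹ * (h * x)) := by
      rw [← mul_assoc]
      exact ⟨M.artinMonoid.mul_mem hk.1 hx, hnp⟩
    refine ⟨M.atomDist_le_of_mul hΔ hx hk.1 hs, ?_⟩
    rw [M.wordDist_eq hΔ hs, hup, ← mul_assoc, M.wordLength_mul hk.1 hx]
  by_cases h₁ : M.Prefix M.garside (k⁻¹ * h * P)
  · obtain ⟨ha, hd⟩ := step _ hm₂ (M.not_prefix_of_isNormalForm hL hk hP hLP h₁)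
    have hl := hL.append_right.length_le_wordLength
    refine ⟨le_max_of_le_right ha, lt_max_of_lt_right (by omega), ?_⟩
    omega
  · obtain ⟨ha, hd⟩ := step _ hP h₁
    rw [← ev] at ha hd
    have hl := hL.append_left.wordLength_add_length_le hΔL.1
    rw [← M.wordLength_garside_pow, ← hLP, M.wordLength_mul hm₁ hP] at hl
    refine ⟨le_max_of_le_left ha, lt_max_of_lt_left (by omega), ?_⟩
    omega
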